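/- **Setting.** Two nodes communicate in both directions through a relay, full duplex and without a direct link. All alphabets are finite. In each channel use, nodes 1 and 2 send $X_{12}\in\mathcal X_{12}$ and $X_{21}\in\mathcal X_{21}$, and the relay receives $Y_R$ through a memoryless uplink channel $p(y_R|x_{12},x_{21})$. The relay sends $X_R$, and nodes 1 and 2 receive $Y_1$ and $Y_2$ through a memoryless downlink channel $p(y_1|x_R)\,p(y_2|x_R)$. Logarithms are to base 2 and $[t]^+=\max\{t,0\}$. For input distributions $p(x_{12}),p(x_{21})$ take the joint law $p(x_{12})p(x_{21})p(y_R|x_{12},x_{21})$, and for an auxiliary variable $U$ with finite alphabet and a distribution $q(u,x_R)$ take the joint law $q(u,x_R)p(y_1|x_R)p(y_2|x_R)$. Let $R_{R,2}=I(U;Y_2)$ and $R_{R,1}=I(X_R;Y_1|U)+I(U;Y_2)$. * The *hash-and-forward (HF) rate set* $\mathcal H(p_{12},p_{21},q)$ consists of all $(R_{12},R_{21})$ with $$0\le R_{12}\le\min\{I(X_{12};Y_R|X_{21}),\,[R_{R,2}-H(Y_R|X_{12},X_{21})]^+\},$$ $$0\le R_{21}\le\min\{I(X_{21};Y_R|X_{12}),\,[R_{R,1}-H(Y_R|X_{12},X_{21})]^+\}.$$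 Let $\mathcal H(p_{12},p_{21})$ be its union over all finite alphabets of $U$ and all $q$, and $\mathcal H$ the union of these sets over all $p_{12},p_{21}$. The HF region is the closure of $\mathcal H$, or, with time sharing, the closed convex hull of $\mathcal H$. * *Shannon's rate set* $\mathcal S(p_{12},p_{21})$ for the two-way channel with common output $Y_R$ consists of all $(R_{12},R_{21})$ with $0\le R_{12}\le I(X_{12};Y_R|X_{21})$ and $0\le R_{21}\le I(X_{21};Y_R|X_{12})$. Let $\mathcal S$ be its union over all $p_{12},p_{21}$. Shannon's inner bound is the closed convex hull of $\mathcal S$. * A pair $(R_{12},R_{21})$ of nonnegative reals is *achievable by binning at the relay* if for every $\varepsilon>0$ and every sufficiently large $n$ there is a code of length $n$ with at least $2^{n(R_{12}-\varepsilon)}$ and $2^{n(R_{21}-\varepsilon)}$ messages in the two directions and, for independent uniform messages, error probability at most $\varepsilon$ at each node, such that: the words sent by the nodes depend only on their messages; the time is cut into blocks of some length $m$; the relay sends a fixed word in the first block, and in every later block a codeword determined by the bin (hash value) of the word $y_R^m$ that it received in the preceding block; each node decodes from its received sequence and its own message. **Statement.** Suppose that the downlink channels are identical, $p(y_1|x_R)=p(y_2|x_R)$.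 1. If $p(x_{12}),p(x_{21}),p(x_R)$ are such that $$I(X_R;Y_1)\ \ge\ \max\{H(Y_R|X_{12}),\,H(Y_R|X_{21})\},\qquad(*)$$ then, with the choice $U=X_R$, one has $R_{R,1}=R_{R,2}=I(X_R;Y_1)$, and for the corresponding $q$ $$\mathcal H(p_{12},p_{21},q)=\mathcal H(p_{12},p_{21})=\mathcal S(p_{12},p_{21}).$$ Every rate pair in this set is achievable by binning at the relay. 2. If for all $p(x_{12}),p(x_{21})$ there is a $p(x_R)$ with $(*)$, then the HF region coincides with Shannon's inner bound: $\mathcal H$ and $\mathcal S$ have the same closure, and the closed convex hull of $\mathcal H$ is Shannon's inner bound. Every rate pair in Shannon's inner bound is achievable by binning at the relay. -/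

import Mathlib

noncomputable section

namespace TwoWayRelay

/-! Information measures (in bits) of random variables on a finite space `Ω` with mass function
`p : Ω → ℝ`. -/

open Classical in
/-- The probability mass function of the random variable `X` under `p`. -/
def law {Ω α : Type*} [Fintype Ω] (p : Ω → ℝ) (X : Ω → α) (a : α) : ℝ :=
  ∑ ω, if X ω = a then p ω else 0

/-- The conditional entropy `H(X | Z) = E[log₂ (1 / p(X | Z))]`. -/
def condEntropy {Ω α γ : Type*} [Fintype Ω] (p : Ω → ℝ) (X : Ω → α) (Z : Ω → γ) : ℝ :=
  ∑ ω, p ω * Real.logb 2 (law p Z (Z ω) / law p (fun ω => (X ω, Z ω)) (X ω, Z ω))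

/-- The mutual information `I(X; Y) = E[log₂ (p(X, Y) / (p(X) p(Y)))]`. -/
def mutualInfo {Ω α β : Type*} [Fintype Ω] (p : Ω → ℝ) (X : Ω → α) (Y : Ω → β) : ℝ :=
  ∑ ω, p ω * Real.logb 2
    (law p (fun ω => (X ω, Y ω)) (X ω, Y ω) / (law p X (X ω) * law p Y (Y ω)))

/-- The conditional mutual information
`I(X; Y | Z) = E[log₂ (p(X, Y, Z) p(Z) / (p(X, Z) p(Y, Z)))]`. -/
def condMutualInfo {Ω α β γ : Type*} [Fintype Ω] (p : Ω → ℝ)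
    (X : Ω → α) (Y : Ω → β) (Z : Ω → γ) : ℝ :=
  ∑ ω, p ω * Real.logb 2
    ((law p (fun ω => (X ω, Y ω, Z ω)) (X ω, Y ω, Z ω) * law p Z (Z ω)) /
      (law p (fun ω => (X ω, Z ω)) (X ω, Z ω) * law p (fun ω => (Y ω, Z ω)) (Y ω, Z ω)))

/-! Single-letter rate regions. A discrete memoryless channel is its matrix of transition
probabilities. A rate pair `R` is `(R₁₂, R₂₁)`. -/

section Regions

variable {X12 X21 YR XR Y1 Y2 U : Type*}

/-- The uplink joint law `p(x₁₂) p(x₂₁) p(y_R | x₁₂, x₂₁)`. -/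
def uplinkLaw (p12 : X12 → ℝ) (p21 : X21 → ℝ) (W : X12 → X21 → YR → ℝ) :
    X12 × X21 × YR → ℝ :=
  fun ω => p12 ω.1 * p21 ω.2.1 * W ω.1 ω.2.1 ω.2.2

/-- The downlink joint law `p(u, x_R) p(y₁ | x_R) p(y₂ | x_R)`. -/
def downlinkLaw (q : U × XR → ℝ) (V1 : XR → Y1 → ℝ) (V2 : XR → Y2 → ℝ) :
    U × XR × Y1 × Y2 → ℝ :=
  fun ω => q (ω.1, ω.2.1) * V1 ω.2.1 ω.2.2.1 * V2 ω.2.1 ω.2.2.2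

/-- `I(X; Y)` for an input distribution `p` and a channel `V` from `X` to `Y`. -/
def channelInfo {X Y : Type*} [Fintype X] [Fintype Y] (p : X → ℝ) (V : X → Y → ℝ) : ℝ :=
  mutualInfo (fun ω : X × Y => p ω.1 * V ω.1 ω.2) (fun ω => ω.1) (fun ω => ω.2)

/-- The law of `(U, X_R)` with `U = X_R` distributed according to `p`. -/
def diagLaw {X : Type*} [DecidableEq X] (p : X → ℝ) : X × X → ℝ :=
  fun ω => if ω.1 = ω.2 then p ω.2 else 0

section Quantities

variable [Fintype X12] [Fintype X21] [Fintype YR]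

/-- `I(X₁₂; Y_R | X₂₁)`. -/
def uplinkInfo12 (p12 : X12 → ℝ) (p21 : X21 → ℝ) (W : X12 → X21 → YR → ℝ) : ℝ :=
  condMutualInfo (uplinkLaw p12 p21 W) (fun ω => ω.1) (fun ω => ω.2.2) (fun ω => ω.2.1)

/-- `I(X₂₁; Y_R | X₁₂)`. -/
def uplinkInfo21 (p12 : X12 → ℝ) (p21 : X21 → ℝ) (W : X12 → X21 → YR → ℝ) : ℝ :=
  condMutualInfo (uplinkLaw p12 p21 W) (fun ω => ω.2.1) (fun ω => ω.2.2) (fun ω => ω.1)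

/-- `H(Y_R | X₁₂)`. -/
def relayEntropyGiven12 (p12 : X12 → ℝ) (p21 : X21 → ℝ) (W : X12 → X21 → YR → ℝ) : ℝ :=
  condEntropy (uplinkLaw p12 p21 W) (fun ω => ω.2.2) (fun ω => ω.1)

/-- `H(Y_R | X₂₁)`. -/
def relayEntropyGiven21 (p12 : X12 → ℝ) (p21 : X21 → ℝ) (W : X12 → X21 → YR → ℝ) : ℝ :=
  condEntropy (uplinkLaw p12 p21 W) (fun ω => ω.2.2) (fun ω => ω.2.1)

/-- `H(Y_R | X₁₂, X₂₁)`. -/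
def relayEntropyGivenBoth (p12 : X12 → ℝ) (p21 : X21 → ℝ) (W : X12 → X21 → YR → ℝ) : ℝ :=
  condEntropy (uplinkLaw p12 p21 W) (fun ω => ω.2.2) (fun ω => (ω.1, ω.2.1))

end Quantities

section Downlink

variable [Fintype U] [Fintype XR] [Fintype Y1] [Fintype Y2]

/-- The downlink rate `R_{R,2} = I(U; Y₂)` to the weaker receiver, node 2. -/
def downlinkRate2 (q : U × XR → ℝ) (V1 : XR → Y1 → ℝ) (V2 : XR → Y2 → ℝ) : ℝ :=
  mutualInfo (downlinkLaw q V1 V2) (fun ω => ω.1) (fun ω => ω.2.2.2)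

/-- The downlink rate `R_{R,1} = I(X_R; Y₁ | U) + I(U; Y₂)` to the stronger receiver, node 1. -/
def downlinkRate1 (q : U × XR → ℝ) (V1 : XR → Y1 → ℝ) (V2 : XR → Y2 → ℝ) : ℝ :=
  condMutualInfo (downlinkLaw q V1 V2) (fun ω => ω.2.1) (fun ω => ω.2.2.1) (fun ω => ω.1)
    + downlinkRate2 q V1 V2

end Downlink

variable [Fintype X12] [Fintype X21] [Fintype YR] [Fintype XR] [Fintype Y1] [Fintype Y2]

/-- The hash-and-forward rate pairs for fixed distributions `p(x₁₂)`, `p(x₂₁)`, `q(u, x_R)`;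
`max t 0` is the positive part of `t`. -/
def hfRect [Fintype U] (p12 : X12 → ℝ) (p21 : X21 → ℝ) (q : U × XR → ℝ)
    (W : X12 → X21 → YR → ℝ) (V1 : XR → Y1 → ℝ) (V2 : XR → Y2 → ℝ) : Set (ℝ × ℝ) :=
  {R | 0 ≤ R.1 ∧ 0 ≤ R.2 ∧
    R.1 ≤ min (uplinkInfo12 p12 p21 W)
      (max (downlinkRate2 q V1 V2 - relayEntropyGivenBoth p12 p21 W) 0) ∧
    R.2 ≤ min (uplinkInfo21 p12 p21 W)
      (max (downlinkRate1 q V1 V2 - relayEntropyGivenBoth p12 p21 W) 0)}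

/-- The hash-and-forward rate pairs for fixed uplink distributions, over all finite auxiliary
alphabets and all `q(u, x_R)`. -/
def hfRatesAt (p12 : X12 → ℝ) (p21 : X21 → ℝ)
    (W : X12 → X21 → YR → ℝ) (V1 : XR → Y1 → ℝ) (V2 : XR → Y2 → ℝ) : Set (ℝ × ℝ) :=
  {R | ∃ k : ℕ, ∃ q ∈ stdSimplex ℝ (Fin k × XR), R ∈ hfRect p12 p21 q W V1 V2}

/-- All hash-and-forward rate pairs, over all product distributions of the uplink inputs. -/
def hfRates (W : X12 → X21 → YR → ℝ) (V1 : XR → Y1 → ℝ) (V2 : XR → Y2 → ℝ) : Set (ℝ × ℝ) :=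
  {R | ∃ p12 ∈ stdSimplex ℝ X12, ∃ p21 ∈ stdSimplex ℝ X21, R ∈ hfRatesAt p12 p21 W V1 V2}

/-- Shannon's inner-bound rate pairs of the two-way channel with common output `Y_R`, for fixed
independent inputs. -/
def shannonRect (p12 : X12 → ℝ) (p21 : X21 → ℝ) (W : X12 → X21 → YR → ℝ) : Set (ℝ × ℝ) :=
  {R | 0 ≤ R.1 ∧ 0 ≤ R.2 ∧ R.1 ≤ uplinkInfo12 p12 p21 W ∧ R.2 ≤ uplinkInfo21 p12 p21 W}

/-- Shannon's inner-bound rate pairs over all product input distributions, before time sharing. -/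
def shannonRates (W : X12 → X21 → YR → ℝ) : Set (ℝ × ℝ) :=
  {R | ∃ p12 ∈ stdSimplex ℝ X12, ∃ p21 ∈ stdSimplex ℝ X21, R ∈ shannonRect p12 p21 W}

/-- Shannon's inner bound: the closed convex hull of the rate pairs over product inputs. -/
def shannonInnerBound (W : X12 → X21 → YR → ℝ) : Set (ℝ × ℝ) :=
  closure (convexHull ℝ (shannonRates W))

/-- The downlink is very strong for given input distributions:
`I(X_R; Y) ≥ max {H(Y_R | X₁₂), H(Y_R | X₂₁)}`. -/
def StrongDownlink (p12 : X12 → ℝ) (p21 : X21 → ℝ) (pR : XR → ℝ)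
    (W : X12 → X21 → YR → ℝ) (V : XR → Y1 → ℝ) : Prop :=
  max (relayEntropyGiven12 p12 p21 W) (relayEntropyGiven21 p12 p21 W) ≤ channelInfo pR V

end Regions

/-! The operational model. -/

/-- The values of `y` strictly before time `i`. -/
def past {n : ℕ} {Y : Type*} (y : Fin n → Y) (i : Fin n) : Fin (i : ℕ) → Y :=
  fun j => y (Fin.castLE i.isLt.le j)

/-- A code of length `n` for the full-duplex two-way relay network, with `M12` messages from
node 1 to node 2 and `M21` messages from node 2 to node 1. Nodes and relay encode causally. -/
structure Code (X12 X21 YR XR Y1 Y2 : Type*) (n M12 M21 : ℕ) where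
  enc12 : Fin M12 → (i : Fin n) → (Fin (i : ℕ) → Y1) → X12
  enc21 : Fin M21 → (i : Fin n) → (Fin (i : ℕ) → Y2) → X21
  relay : (i : Fin n) → (Fin (i : ℕ) → YR) → XR
  dec1 : (Fin n → Y1) → Fin M12 → Fin M21
  dec2 : (Fin n → Y2) → Fin M21 → Fin M12

namespace Code

variable {X12 X21 YR XR Y1 Y2 : Type*} {n M12 M21 : ℕ}

/-- The probability that the relay and the nodes receive `yR`, `y1`, `y2` when the messages are
`w12`, `w21`. -/
def outputProb (c : Code X12 X21 YR XR Y1 Y2 n M12 M21)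
    (W : X12 → X21 → YR → ℝ) (V1 : XR → Y1 → ℝ) (V2 : XR → Y2 → ℝ)
    (w12 : Fin M12) (w21 : Fin M21)
    (yR : Fin n → YR) (y1 : Fin n → Y1) (y2 : Fin n → Y2) : ℝ :=
  ∏ i, W (c.enc12 w12 i (past y1 i)) (c.enc21 w21 i (past y2 i)) (yR i)
    * V1 (c.relay i (past yR i)) (y1 i) * V2 (c.relay i (past yR i)) (y2 i)

variable [Fintype YR] [Fintype Y1] [Fintype Y2]

/-- The error probability at node 1, for independent uniform messages. -/
def errorProb1 (c : Code X12 X21 YR XR Y1 Y2 n M12 M21)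
    (W : X12 → X21 → YR → ℝ) (V1 : XR → Y1 → ℝ) (V2 : XR → Y2 → ℝ) : ℝ :=
  (∑ w12, ∑ w21, ∑ yR, ∑ y1, ∑ y2,
    if c.dec1 y1 w12 ≠ w21 then c.outputProb W V1 V2 w12 w21 yR y1 y2 else 0) / (M12 * M21)

/-- The error probability at node 2, for independent uniform messages. -/
def errorProb2 (c : Code X12 X21 YR XR Y1 Y2 n M12 M21)
    (W : X12 → X21 → YR → ℝ) (V1 : XR → Y1 → ℝ) (V2 : XR → Y2 → ℝ) : ℝ :=
  (∑ w12, ∑ w21, ∑ yR, ∑ y1, ∑ y2,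
    if c.dec2 y2 w21 ≠ w12 then c.outputProb W V1 V2 w12 w21 yR y1 y2 else 0) / (M12 * M21)

/-- The code uses binning at the relay: time is cut into blocks of length `m`, the relay sends a
fixed word in the first block, and in each later block the codeword `word k`, where `k` is the
bin of the word that it received in the preceding block. The nodes do not use what they receive
for encoding. -/
def IsHashForward (c : Code X12 X21 YR XR Y1 Y2 n M12 M21) : Prop :=
  (∃ x12 : Fin M12 → Fin n → X12, ∀ w i y, c.enc12 w i y = x12 w i) ∧
  (∃ x21 : Fin M21 → Fin n → X21, ∀ w i y, c.enc21 w i y = x21 w i) ∧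
  ∃ (m K : ℕ) (bin : (Fin m → YR) → Fin K) (word : Fin K → Fin m → XR) (init : Fin m → XR),
    0 < m ∧
    (∀ (t : Fin m) (h : (t : ℕ) < n) (y : Fin (t : ℕ) → YR), c.relay ⟨t, h⟩ y = init t) ∧
    (∀ (b : ℕ) (t : Fin m) (h : (b + 1) * m + t < n) (y : Fin ((b + 1) * m + t) → YR),
      c.relay ⟨(b + 1) * m + t, h⟩ y =
        word (bin fun j => y ⟨b * m + j, by have := j.isLt; rw [Nat.succ_mul]; omega⟩) t)

end Code

/-- The rate pairs achievable with vanishing error probability by binning at the relay. -/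
def hfAchievable {X12 X21 YR XR Y1 Y2 : Type*} [Fintype YR] [Fintype Y1] [Fintype Y2]
    (W : X12 → X21 → YR → ℝ) (V1 : XR → Y1 → ℝ) (V2 : XR → Y2 → ℝ) : Set (ℝ × ℝ) :=
  {R | 0 ≤ R.1 ∧ 0 ≤ R.2 ∧ ∀ ε > 0, ∃ N : ℕ, ∀ n ≥ N, ∃ M12 M21 : ℕ,
    ∃ c : Code X12 X21 YR XR Y1 Y2 n M12 M21, c.IsHashForward ∧
      (2 : ℝ) ^ ((n : ℝ) * (R.1 - ε)) ≤ M12 ∧ (2 : ℝ) ^ ((n : ℝ) * (R.2 - ε)) ≤ M21 ∧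
      c.errorProb1 W V1 V2 ≤ ε ∧ c.errorProb2 W V1 V2 ≤ ε}

end TwoWayRelay

end

/-! Single-letter part. The chain rule gives `I(X₁₂; Y_R | X₂₁) + H(Y_R | X₁₂, X₂₁) = H(Y_R | X₂₁)`,
and symmetrically in the other direction. Taking `U = X_R` makes `I(X_R; Y₁ | U)` vanish, so both
downlink rates equal `I(X_R; Y₁)`. Under the strong downlink condition the relay terms in the two
minima therefore never bind, and the hash-and-forward rectangle is Shannon's
(`hfRect_eq_shannonRect`). The reverse inclusion, for any other `q`, is immediate from the minimum.
Equality for every input pair passes to unions, closures and hulls.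

Operational part. Within one block all four ingredients are random: both codebooks, the binning of
the relay's words, and the codewords of the bins. A node first decodes the bin and then looks for a
message compatible with some word in that bin. A wrong message survives either with the word
actually received, which is rare below the rate `I`, or with another typical word in the same bin,
which is rare when `I + H(Y_R | X₁₂, X₂₁)` is below the downlink rate; this is again the chain rule.
The tests are likelihood inequalities rather than typical sets: exactly what the change of measure
and the count of words need (`channel_random_coding`, `hash_random_coding`). By Chebyshev's
inequality the true words pass them (`eventually_tail_le`).

`B` such blocks, pipelined over `B + 1` time blocks, give a code whose error is controlled by a
union bound and whose rate loss vanishes for large `B` (`mean_blocks_le`, `rpow_le_pow_of_blocks`).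
The bin map has to be the same in every block, so time sharing takes place inside a block: each
position has its own input laws, and the law of large numbers is uniform over these assignments.
Closedness of the achievable set (`isClosed_hfAchievable`) yields the whole inner bound. -/

namespace TwoWayRelay

open Finset

/-! Finite expectations and product laws. -/

section PiLaw

variable {ι α : Type*} [Fintype ι]

/-- The law of independent random variables with laws `P i`. -/
def piLaw (P : ι → α → ℝ) (f : ι → α) : ℝ := ∏ i, P i (f i)

theorem piLaw_nonneg {P : ι → α → ℝ} (hP : ∀ i a, 0 ≤ P i a) (f : ι → α) : 0 ≤ piLaw P f :=
  prod_nonneg fun i _ => hP i _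

theorem pos_of_piLaw_pos {P : ι → α → ℝ} (hP : ∀ i a, 0 ≤ P i a) {f : ι → α}
    (h : 0 < piLaw P f) (i : ι) : 0 < P i (f i) :=
  (hP i _).lt_of_ne' fun h0 => h.ne' (prod_eq_zero (mem_univ i) h0)

end PiLaw

section Mean

variable {α β ι κ : Type*} [Fintype α] [Fintype β]

/-- The expectation of `F` under the mass function `p`. -/
noncomputable def mean (p : α → ℝ) (F : α → ℝ) : ℝ := ∑ a, p a * F a

open Classical in
/-- The indicator of a proposition. -/
noncomputable def ind (P : Prop) : ℝ := if P then 1 else 0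

theorem ind_nonneg (P : Prop) : 0 ≤ ind P := by
  unfold ind; split_ifs <;> norm_num

theorem ind_of_true {P : Prop} (h : P) : ind P = 1 := if_pos h

theorem ind_of_false {P : Prop} (h : ¬P) : ind P = 0 := if_neg h

theorem ind_le_one (P : Prop) : ind P ≤ 1 := by
  unfold ind; split_ifs <;> norm_num

theorem ind_mono {P Q : Prop} (h : P → Q) : ind P ≤ ind Q := by
  by_cases hP : P
  · rw [ind_of_true hP, ind_of_true (h hP)]
  · rw [ind_of_false hP]; exact ind_nonneg Q

theorem ind_or_le {P Q R : Prop} (h : P → Q ∨ R) : ind P ≤ ind Q + ind R := by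
  by_cases hP : P
  · rcases h hP with h | h
    · rw [ind_of_true hP, ind_of_true h]; linarith [ind_nonneg R]
    · rw [ind_of_true hP, ind_of_true h]; linarith [ind_nonneg Q]
  · rw [ind_of_false hP]; exact add_nonneg (ind_nonneg Q) (ind_nonneg R)

theorem ind_le_sum {P : Prop} {s : Finset ι} {Q : ι → Prop} (h : P → ∃ i ∈ s, Q i) :
    ind P ≤ ∑ i ∈ s, ind (Q i) := by
  by_cases hP : P
  · obtain ⟨i, hi, hQ⟩ := h hP
    rw [ind_of_true hP, ← ind_of_true hQ]
    exact single_le_sum (f := fun i => ind (Q i)) (fun i _ => ind_nonneg _) hi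
  · rw [ind_of_false hP]; exact sum_nonneg fun i _ => ind_nonneg _

theorem mean_mono_of_support {p F G : α → ℝ} (hp : ∀ a, 0 ≤ p a)
    (h : ∀ a, 0 < p a → F a ≤ G a) : mean p F ≤ mean p G := by
  refine sum_le_sum fun a _ => ?_
  rcases (hp a).eq_or_lt with h0 | h0
  · rw [← h0]; simp
  · exact mul_le_mul_of_nonneg_left (h a h0) h0.le

theorem mean_mono {p F G : α → ℝ} (hp : ∀ a, 0 ≤ p a) (h : ∀ a, F a ≤ G a) :
    mean p F ≤ mean p G :=
  mean_mono_of_support hp fun a _ => h a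

theorem mean_congr_of_support {p F G : α → ℝ} (hp : ∀ a, 0 ≤ p a)
    (h : ∀ a, 0 < p a → F a = G a) : mean p F = mean p G :=
  le_antisymm (mean_mono_of_support hp fun a ha => (h a ha).le)
    (mean_mono_of_support hp fun a ha => (h a ha).ge)

theorem mean_nonneg {p F : α → ℝ} (hp : ∀ a, 0 ≤ p a) (h : ∀ a, 0 ≤ F a) : 0 ≤ mean p F :=
  sum_nonneg fun a _ => mul_nonneg (hp a) (h a)

theorem mean_add (p F G : α → ℝ) : mean p (fun a => F a + G a) = mean p F + mean p G := by
  simp only [mean, mul_add, sum_add_distrib]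

theorem mean_sub (p F G : α → ℝ) : mean p (fun a => F a - G a) = mean p F - mean p G := by
  simp only [mean, mul_sub, sum_sub_distrib]

theorem mean_sum (p : α → ℝ) (s : Finset ι) (F : ι → α → ℝ) :
    mean p (fun a => ∑ i ∈ s, F i a) = ∑ i ∈ s, mean p (F i) := by
  simp only [mean, mul_sum]; exact sum_comm

theorem mean_mul_left (p : α → ℝ) (c : ℝ) (F : α → ℝ) :
    mean p (fun a => c * F a) = c * mean p F := by
  simp only [mean, mul_sum]; exact sum_congr rfl fun a _ => by ring

theorem mean_const {p : α → ℝ} (hp : p ∈ stdSimplex ℝ α) (c : ℝ) : mean p (fun _ => c) = c := by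
  simp only [mean, ← sum_mul, hp.2, one_mul]

theorem mean_comm (p : α → ℝ) (q : β → ℝ) (F : α → β → ℝ) :
    mean p (fun a => mean q (F a)) = mean q (fun b => mean p fun a => F a b) := by
  simp only [mean, mul_sum]
  rw [sum_comm]
  exact sum_congr rfl fun a _ => sum_congr rfl fun b _ => by ring

/-- Derandomization: used to fix the random components of the code one at a time. -/
theorem exists_le_of_mean_le {p F : α → ℝ} (hp : p ∈ stdSimplex ℝ α) {c : ℝ}
    (h : mean p F ≤ c) : ∃ a, F a ≤ c := by
  by_contra! hc
  have h1 : ∑ a, p a * c < ∑ a, p a * F a := by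
    obtain ⟨a, ha⟩ : ∃ a, 0 < p a := by
      by_contra! h0
      have := hp.2
      rw [sum_eq_zero fun a _ => le_antisymm (h0 a) (hp.1 a)] at this
      norm_num at this
    exact sum_lt_sum (fun a _ => mul_le_mul_of_nonneg_left (hc a).le (hp.1 a))
      ⟨a, mem_univ _, mul_lt_mul_of_pos_left (hc a) ha⟩
  rw [← sum_mul, hp.2, one_mul] at h1
  exact absurd h (not_le.2 h1)

/-- The uniform mass function. -/
noncomputable def unif (α : Type*) [Fintype α] : α → ℝ := fun _ => (Fintype.card α : ℝ)⁻¹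

theorem unif_mem [Nonempty α] : unif α ∈ stdSimplex ℝ α := by
  refine ⟨fun _ => by unfold unif; positivity, ?_⟩
  simp [unif]

variable [Fintype ι] [DecidableEq ι] [Fintype κ] [DecidableEq κ]

theorem mean_piLaw_prod (P k : ι → α → ℝ) :
    mean (piLaw P) (fun f => ∏ i, k i (f i)) = ∏ i, mean (P i) (k i) := by
  simp only [mean, piLaw, ← prod_mul_distrib]
  rw [prod_univ_sum, Fintype.piFinset_univ]

theorem piLaw_mem {P : ι → α → ℝ} (hP : ∀ i, P i ∈ stdSimplex ℝ α) :
    piLaw P ∈ stdSimplex ℝ (ι → α) := by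
  refine ⟨piLaw_nonneg fun i => (hP i).1, ?_⟩
  have := mean_piLaw_prod P fun _ _ => 1
  simpa [mean, (hP _).2] using this

/-- Marginalization: the index set splits into the range of `e` and its complement, and the factor
of the complement sums to one. It restricts a law to one coordinate, to two coordinates, or to one
time block. -/
theorem mean_piLaw_comp {P : ι → α → ℝ} (hP : ∀ i, P i ∈ stdSimplex ℝ α) {e : κ → ι}
    (he : Function.Injective e) (g : (κ → α) → ℝ) :
    mean (piLaw P) (fun f => g (f ∘ e)) = mean (piLaw fun k => P (e k)) g := by
  classical
  let E : κ ⊕ ((Set.range e)ᶜ : Set ι) ≃ ι :=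
    (Equiv.sumCongr (Equiv.ofInjective e he) (Equiv.refl _)).trans (Equiv.Set.sumCompl (Set.range e))
  have hl : ∀ k, E (Sum.inl k) = e k := fun k => rfl
  have hr : ∀ c, E (Sum.inr c) = c := fun c => rfl
  let F : (κ → α) × (((Set.range e)ᶜ : Set ι) → α) ≃ (ι → α) :=
    (Equiv.sumArrowEquivProdArrow _ _ _).symm.trans (Equiv.arrowCongr E (Equiv.refl _))
  have hF : ∀ x i, F x (E i) = Sum.elim x.1 x.2 i := fun x i => by
    rcases i with i | i <;> simp [F, Equiv.arrowCongr, Equiv.sumArrowEquivProdArrow]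
  unfold mean
  rw [← Equiv.sum_comp F, Fintype.sum_prod_type]
  refine sum_congr rfl fun h _ => ?_
  have h1 : ∀ h' : ((Set.range e)ᶜ : Set ι) → α, F (h, h') ∘ e = h := fun h' => by
    funext k
    have := hF (h, h') (Sum.inl k)
    rwa [hl] at this
  have h2 : ∀ h' : ((Set.range e)ᶜ : Set ι) → α, piLaw P (F (h, h')) =
      piLaw (fun k => P (e k)) h * piLaw (fun c : ((Set.range e)ᶜ : Set ι) => P c) h' := fun h' => by
    unfold piLaw
    rw [← Equiv.prod_comp E, Fintype.prod_sum_type]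
    simp only [hF]
    rfl
  simp only [h1, h2]
  rw [← sum_mul, ← mul_sum,
    (piLaw_mem fun c : ((Set.range e)ᶜ : Set ι) => hP c).2, mul_one]

theorem mean_piLaw_apply {P : ι → α → ℝ} (hP : ∀ i, P i ∈ stdSimplex ℝ α) (i : ι) (g : α → ℝ) :
    mean (piLaw P) (fun f => g (f i)) = mean (P i) g := by
  have := mean_piLaw_comp hP (e := fun _ : Unit => i) (fun _ _ _ => rfl) (fun h => g (h ()))
  refine this.trans ?_
  unfold mean
  rw [← Equiv.sum_comp (Equiv.funUnique Unit α).symm]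
  simp [piLaw]

theorem mean_piLaw_apply₂ {P : ι → α → ℝ} (hP : ∀ i, P i ∈ stdSimplex ℝ α) {i j : ι} (hij : i ≠ j)
    (g : α → α → ℝ) :
    mean (piLaw P) (fun f => g (f i) (f j)) = mean (P i) fun a => mean (P j) fun b => g a b := by
  have := mean_piLaw_comp hP (e := ![i, j])
    (by intro x y; fin_cases x <;> fin_cases y <;> simp [hij, hij.symm]) (fun h => g (h 0) (h 1))
  refine this.trans ?_
  unfold mean
  rw [← Equiv.sum_comp (finTwoArrowEquiv α).symm, Fintype.sum_prod_type]
  simp [piLaw, mul_sum, mul_assoc]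

/-- A memoryless channel with independent inputs produces independent pairs, so Chebyshev's
inequality applies to averages over codewords and channel noise together. -/
theorem mean_piLaw_bind (p : ι → α → ℝ) (K : ι → α → β → ℝ) (F : (ι → α) → (ι → β) → ℝ) :
    mean (piLaw p) (fun a => mean (piLaw fun i => K i (a i)) fun b => F a b) =
      mean (piLaw fun i (ω : α × β) => p i ω.1 * K i ω.1 ω.2)
        fun ω => F (fun i => (ω i).1) (fun i => (ω i).2) := by
  unfold mean
  rw [← Equiv.sum_comp (Equiv.arrowProdEquivProdArrow ι (fun _ => α) (fun _ => β)).symm,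
    Fintype.sum_prod_type]
  simp only [piLaw, Equiv.arrowProdEquivProdArrow, Equiv.coe_fn_symm_mk, mul_sum, prod_mul_distrib,
    mul_assoc]

/-- Chebyshev's inequality (lower tail) for sums of independent variables. -/
theorem chebyshev_lower {P : ι → α → ℝ} (hP : ∀ i, P i ∈ stdSimplex ℝ α) (h : ι → α → ℝ)
    {r : ℝ} (hr : 0 < r) :
    mean (piLaw P) (fun f => ind (∑ i, h i (f i) < ∑ i, mean (P i) (h i) - r)) ≤
      (∑ i, mean (P i) fun a => (h i a - mean (P i) (h i)) ^ 2) / r ^ 2 := by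
  set d : ι → α → ℝ := fun i a => h i a - mean (P i) (h i) with hd
  have hd0 : ∀ i, mean (P i) (d i) = 0 := fun i => by
    rw [hd]; simp only; rw [mean_sub, mean_const (hP i), sub_self]
  have hsq : mean (piLaw P) (fun f => (∑ i, d i (f i)) ^ 2) =
      ∑ i, mean (P i) fun a => d i a ^ 2 := by
    simp only [sq, sum_mul_sum]
    rw [mean_sum]
    refine sum_congr rfl fun i _ => ?_
    rw [mean_sum, sum_eq_single i]
    · exact mean_piLaw_apply hP i fun a => d i a * d i a
    -- Cross terms vanish by independence, since each `d i` is centred.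
    · intro j _ hji
      rw [mean_piLaw_apply₂ hP hji.symm fun a b => d i a * d j b]
      simp only [mean_mul_left, hd0, mul_zero]
      simp [mean]
    · simp
  rw [le_div_iff₀ (by positivity), ← hsq, mul_comm, ← mean_mul_left]
  refine mean_mono (piLaw_mem hP).1 fun f => ?_
  by_cases hf : ∑ i, h i (f i) < ∑ i, mean (P i) (h i) - r
  · rw [ind_of_true hf, mul_one]
    have : ∑ i, d i (f i) < -r := by
      simp only [hd, sum_sub_distrib]; linarith
    nlinarith
  · rw [ind_of_false hf, mul_zero]; positivity

end Mean

end TwoWayRelay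

namespace TwoWayRelay

open Finset

/-! One-shot random coding. -/

section OneShot

variable {A B S X Y : Type*} [Fintype A] [Fintype B] [Fintype S] [Fintype X] [Fintype Y]

/-- The decoders choose any candidate that passes a test. Such a choice goes wrong only if the true
candidate fails or a false one passes. -/
theorem not_or_exists_of_epsilon_ne {α : Type*} [Nonempty α] {P : α → Prop} {a : α}
    (h : Classical.epsilon P ≠ a) : ¬P a ∨ ∃ a', a' ≠ a ∧ P a' := by
  by_cases ha : P a
  · exact Or.inr ⟨_, h, Classical.epsilon_spec ⟨a, ha⟩⟩
  · exact Or.inl ha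

theorem ind_epsilon_ne_le {α : Type*} [Fintype α] [DecidableEq α] [Nonempty α] (P : α → Prop)
    (a : α) : ind (Classical.epsilon P ≠ a) ≤ ind (¬P a) + ∑ a' ∈ univ.erase a, ind (P a') := by
  refine (ind_or_le not_or_exists_of_epsilon_ne).trans ?_
  gcongr
  exact ind_le_sum fun ⟨a', h1, h2⟩ => ⟨a', by simp [h1], h2⟩

/-- The output law of the channel `V` with input law `p`. -/
noncomputable def outLaw (p : X → ℝ) (V : X → Y → ℝ) (y : Y) : ℝ := mean p fun x => V x y

/-- A competing codeword is independent of the one sent, so against it only the output law matters.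
-/
theorem mean_mean_const (p : X → ℝ) (V : X → Y → ℝ) (F : Y → ℝ) :
    mean p (fun x => mean (V x) F) = mean (outLaw p V) F := by
  simp only [outLaw, mean, sum_mul, mul_sum]
  rw [sum_comm]
  exact sum_congr rfl fun a _ => sum_congr rfl fun b _ => by ring

/-- The average error of a random channel code. -/
theorem channel_random_coding {pX : X → ℝ} (hp : pX ∈ stdSimplex ℝ X) {V : X → Y → ℝ}
    (hV : ∀ x, V x ∈ stdSimplex ℝ Y) {T : X → Y → Prop} {K : ℕ} [NeZero K] {κ g : ℝ}
    (hK : (K : ℝ) - 1 ≤ κ) (hg : 0 ≤ g) (hT : ∀ x y, T x y → κ * outLaw pX V y ≤ g * V x y)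
    (k : Fin K) :
    mean (piLaw fun _ : Fin K => pX) (fun word => mean (V (word k)) fun y =>
      ind (Classical.epsilon (fun k' => T (word k') y) ≠ k)) ≤
      mean pX (fun x => mean (V x) fun y => ind (¬T x y)) + g := by
  have hout : ∀ y, 0 ≤ outLaw pX V y := fun y => mean_nonneg hp.1 fun x => (hV x).1 y
  have hK1 : (0 : ℝ) ≤ (K : ℝ) - 1 := by
    have : 1 ≤ K := NeZero.one_le
    have : (1 : ℝ) ≤ K := by exact_mod_cast this
    linarith
  have hpair : ∀ k' ∈ univ.erase k, mean (piLaw fun _ : Fin K => pX) (fun word =>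
      mean (V (word k)) fun y => ind (T (word k') y)) =
      mean pX fun x' => mean (outLaw pX V) fun y => ind (T x' y) := fun k' hk' => by
    rw [mean_piLaw_apply₂ (fun _ => hp) (ne_of_mem_erase hk').symm
      (fun x x' => mean (V x) fun y => ind (T x' y)), mean_comm]
    simp only [mean_mean_const]
  calc _ ≤ mean (piLaw fun _ : Fin K => pX) (fun word => mean (V (word k)) (fun y =>
          ind (¬T (word k) y)) + ∑ k' ∈ univ.erase k, mean (V (word k)) fun y =>
            ind (T (word k') y)) := by
        refine mean_mono (piLaw_mem fun _ => hp).1 fun word => ?_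
        rw [← mean_sum, ← mean_add]
        exact mean_mono (hV _).1 fun y => ind_epsilon_ne_le (fun k' => T (word k') y) k
    _ = mean pX (fun x => mean (V x) fun y => ind (¬T x y)) +
          ((K : ℝ) - 1) * mean pX fun x' => mean (outLaw pX V) fun y => ind (T x' y) := by
        rw [mean_add, mean_sum, sum_congr rfl hpair, sum_const, card_erase_of_mem (mem_univ k),
          card_univ, Fintype.card_fin, nsmul_eq_mul, Nat.cast_pred (NeZero.pos K),
          mean_piLaw_apply (fun _ => hp) k fun x => mean (V x) fun y => ind (¬T x y)]
    _ ≤ _ := by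
        gcongr
        -- Change of measure: where the test holds, the output law times `κ` is at most `g * V x y`,
        -- and `V x` has total mass one.
        rw [← mean_mul_left, ← mean_const hp g]
        refine mean_mono hp.1 fun x => ?_
        rw [← mean_mul_left, ← mean_const (hV x) g]
        refine sum_le_sum fun y _ => ?_
        beta_reduce
        by_cases h : T x y
        · rw [ind_of_true h]
          linarith [hT x y h, mul_le_mul_of_nonneg_right hK (hout y)]
        · rw [ind_of_false h]
          have := mul_nonneg ((hV x).1 y) hg
          simpa using this

/-- The average error when an input is recovered from a random hash of the output. -/
theorem hash_random_coding {pA : A → ℝ} (hp : pA ∈ stdSimplex ℝ A) {W : A → S → ℝ}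
    (hW : ∀ a, W a ∈ stdSimplex ℝ S) {T : A → S → Prop} {M K : ℕ} [NeZero M] [NeZero K]
    {θ κ g : ℝ} (hM : (M : ℝ) - 1 ≤ θ) (hκ : κ ≤ K) (hg : 0 ≤ g)
    (hT : ∀ a s, T a s → θ * outLaw pA W s ≤ g * W a s ∧ θ ≤ g * κ * W a s) (w : Fin M) :
    mean (piLaw fun _ : Fin M => pA) (fun f => open Classical in
      mean (piLaw fun _ : S => unif (Fin K)) fun bin => mean (W (f w)) fun s =>
        ind (Classical.epsilon (fun w' => ∃ s', bin s' = bin s ∧ T (f w') s') ≠ w)) ≤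
      mean pA (fun a => mean (W a) fun s => ind (¬T a s)) + 2 * g := by
  classical
  have hK0 : (0 : ℝ) < K := by exact_mod_cast NeZero.pos K
  have hout : ∀ s, 0 ≤ outLaw pA W s := fun s => mean_nonneg hp.1 fun a => (hW a).1 s
  have hM1 : (0 : ℝ) ≤ (M : ℝ) - 1 := by
    have : 1 ≤ M := NeZero.one_le
    have : (1 : ℝ) ≤ M := by exact_mod_cast this
    linarith
  have hu : ∀ _ : S, unif (Fin K) ∈ stdSimplex ℝ (Fin K) := fun _ => unif_mem
  -- Union bound on the probability that a given bin contains some other word compatible with `a`: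
  -- the number of compatible words over the number of bins.
  set c : A → ℝ := fun a => (K : ℝ)⁻¹ * ∑ s, ind (T a s) with hc
  have hcoll : ∀ s s' : S, s' ≠ s → mean (piLaw fun _ : S => unif (Fin K))
      (fun bin => ind (bin s' = bin s)) = (K : ℝ)⁻¹ := fun s s' hs => by
    rw [mean_piLaw_apply₂ hu hs fun a b => ind (a = b)]
    have : ∀ a : Fin K, mean (unif (Fin K)) (fun b => ind (a = b)) = (K : ℝ)⁻¹ := fun a => by
      simp [mean, unif, ind]
    simp only [this, mean_const unif_mem]
  have hpt : ∀ (f : Fin M → A) (s : S), mean (piLaw fun _ : S => unif (Fin K)) (fun bin =>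
      ind (Classical.epsilon (fun w' => ∃ s', bin s' = bin s ∧ T (f w') s') ≠ w)) ≤
      ind (¬T (f w) s) + ∑ w' ∈ univ.erase w, (ind (T (f w') s) + c (f w')) := fun f s => by
    calc _ ≤ mean (piLaw fun _ : S => unif (Fin K)) (fun bin => ind (¬T (f w) s) +
          ∑ w' ∈ univ.erase w, (ind (T (f w') s) +
            ∑ s' ∈ univ.erase s, ind (T (f w') s') * ind (bin s' = bin s))) := by
          refine mean_mono (piLaw_mem hu).1 fun bin => (ind_epsilon_ne_le _ w).trans ?_
          -- A wrong message passes either with the received word `s` itself or with a different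
          -- word in the bin of `s`; only the second event involves a hash collision.
          refine add_le_add (ind_mono fun h h' => h ⟨s, rfl, h'⟩) (sum_le_sum fun w' _ => ?_)
          by_cases h0 : T (f w') s
          · rw [ind_of_true h0]
            exact (ind_le_one _).trans (le_add_of_nonneg_right
              (sum_nonneg fun _ _ => mul_nonneg (ind_nonneg _) (ind_nonneg _)))
          · refine le_add_of_nonneg_of_le (ind_nonneg _) ?_
            refine (ind_le_sum (s := univ.erase s) (Q := fun s' => T (f w') s' ∧ bin s' = bin s)
              ?_).trans (sum_le_sum fun s' _ => ?_)
            · rintro ⟨s', h1, h2⟩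
              exact ⟨s', mem_erase.2 ⟨fun h => h0 (h ▸ h2), mem_univ _⟩, h2, h1⟩
            · by_cases h1 : T (f w') s' <;> by_cases h2 : bin s' = bin s <;> simp [ind, h1, h2]
      _ = ind (¬T (f w) s) + ∑ w' ∈ univ.erase w, (ind (T (f w') s) +
            ∑ s' ∈ univ.erase s, ind (T (f w') s') * (K : ℝ)⁻¹) := by
          rw [mean_add, mean_const (piLaw_mem hu), mean_sum]
          congr 1
          refine sum_congr rfl fun w' _ => ?_
          rw [mean_add, mean_const (piLaw_mem hu), mean_sum]
          congr 1
          refine sum_congr rfl fun s' hs' => ?_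
          rw [mean_mul_left, hcoll s s' (ne_of_mem_erase hs')]
      _ ≤ _ := by
          gcongr with w' _
          rw [hc, ← sum_mul, mul_comm]
          refine mul_le_mul_of_nonneg_left ?_ (by positivity)
          exact sum_le_sum_of_subset_of_nonneg (erase_subset _ _) fun _ _ _ => ind_nonneg _
  have hpair : ∀ w' ∈ univ.erase w, mean (piLaw fun _ : Fin M => pA) (fun f =>
      mean (W (f w)) fun s => ind (T (f w') s) + c (f w')) =
      mean pA fun a' => mean (outLaw pA W) (fun s => ind (T a' s)) + c a' := fun w' hw' => by
    rw [mean_piLaw_apply₂ (fun _ => hp) (ne_of_mem_erase hw').symm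
      (fun a a' => mean (W a) fun s => ind (T a' s) + c a'), mean_comm]
    refine sum_congr rfl fun a' _ => ?_
    simp only [mean_add, mean_const (hW _), mean_mean_const, mean_const hp]
  calc _ ≤ mean (piLaw fun _ : Fin M => pA) (fun f => mean (W (f w)) (fun s => ind (¬T (f w) s)) +
          ∑ w' ∈ univ.erase w, mean (W (f w)) fun s => ind (T (f w') s) + c (f w')) := by
        refine mean_mono (piLaw_mem fun _ => hp).1 fun f => ?_
        rw [← mean_sum, ← mean_add, mean_comm]
        exact mean_mono (hW _).1 fun s => hpt f s
    _ = mean pA (fun a => mean (W a) fun s => ind (¬T a s)) + ((M : ℝ) - 1) *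
          mean pA fun a' => mean (outLaw pA W) (fun s => ind (T a' s)) + c a' := by
        rw [mean_add, mean_sum, sum_congr rfl hpair, sum_const, card_erase_of_mem (mem_univ w),
          card_univ, Fintype.card_fin, nsmul_eq_mul, Nat.cast_pred (NeZero.pos M),
          mean_piLaw_apply (fun _ => hp) w fun a => mean (W a) fun s => ind (¬T a s)]
    _ ≤ _ := by
        refine add_le_add le_rfl ?_
        -- Each half of `hT` pays one `g`: the first by change of measure, the second because it
        -- bounds the number of compatible words by `g * κ / θ`, as `W a` sums to one.
        rw [← mean_mul_left, ← mean_const hp (2 * g)]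
        refine mean_mono hp.1 fun a => ?_
        rw [← mean_const (hW a) (2 * g), hc]
        unfold mean
        beta_reduce
        rw [mul_sum, ← sum_add_distrib, mul_sum]
        refine sum_le_sum fun s _ => ?_
        by_cases h : T a s
        · rw [ind_of_true h]
          have h1 : ((M : ℝ) - 1) * (K : ℝ)⁻¹ ≤ g * W a s := by
            rw [← div_eq_mul_inv, div_le_iff₀ hK0]
            have := mul_le_mul_of_nonneg_left hκ (mul_nonneg hg ((hW a).1 s))
            linarith [(hT a s h).2]
          linarith [(hT a s h).1, mul_le_mul_of_nonneg_right hM (hout s)]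
        · rw [ind_of_false h]
          have := mul_nonneg ((hW a).1 s) hg
          simp; linarith

/-- The error probability, at the node that sends message `v`, of a block of hash-and-forward:
the other node sends `f w`, the relay receives `s` and sends `word (bin s)`. -/
noncomputable def blockError {M M' K : ℕ} (W : A → B → S → ℝ) (V : X → Y → ℝ) (f : Fin M → A)
    (h : Fin M' → B) (bin : S → Fin K) (word : Fin K → X) (dec : Y → Fin M' → Fin M)
    (w : Fin M) (v : Fin M') : ℝ :=
  mean (W (f w) (h v)) fun s => mean (V (word (bin s))) fun y => ind (dec y v ≠ w)

/-- The decoder that first recovers the hash and then the message. -/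
noncomputable def hashDecoder {M M' K : ℕ} [NeZero M] [NeZero K] (T : A → B → S → Prop)
    (TV : X → Y → Prop) (f : Fin M → A) (h : Fin M' → B) (bin : S → Fin K) (word : Fin K → X)
    (y : Y) (v : Fin M') : Fin M :=
  Classical.epsilon fun w' => ∃ s', bin s' = Classical.epsilon (fun k => TV (word k) y) ∧
    T (f w') (h v) s'

-- The two decoding stages add up: `g` for competing bin indices, `2 * g` for competing messages
-- once the bin is known, plus the probabilities that the true words fail their tests.
open Classical in
theorem mean_blockError_le {pA : A → ℝ} (hpA : pA ∈ stdSimplex ℝ A) {pB : B → ℝ}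
    (hpB : pB ∈ stdSimplex ℝ B) {pX : X → ℝ} (hpX : pX ∈ stdSimplex ℝ X)
    {W : A → B → S → ℝ} (hW : ∀ a b, W a b ∈ stdSimplex ℝ S) {V : X → Y → ℝ}
    (hV : ∀ x, V x ∈ stdSimplex ℝ Y) {T : A → B → S → Prop} {TV : X → Y → Prop}
    {M M' K : ℕ} [NeZero M] [NeZero K] {θ κ g : ℝ} (hM : (M : ℝ) - 1 ≤ θ) (hK : (K : ℝ) - 1 ≤ κ)
    (hκ : κ ≤ K) (hg : 0 ≤ g)
    (hT : ∀ a b s, T a b s →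
      θ * outLaw pA (fun a => W a b) s ≤ g * W a b s ∧ θ ≤ g * κ * W a b s)
    (hTV : ∀ x y, TV x y → κ * outLaw pX V y ≤ g * V x y) (w : Fin M) (v : Fin M') :
    mean (piLaw fun _ : Fin M => pA) (fun f => mean (piLaw fun _ : Fin M' => pB) fun h =>
      mean (piLaw fun _ : S => unif (Fin K)) fun bin => mean (piLaw fun _ : Fin K => pX)
        fun word => blockError W V f h bin word (hashDecoder T TV f h bin word) w v) ≤
      mean pA (fun a => mean pB fun b => mean (W a b) fun s => ind (¬T a b s)) +
        mean pX (fun x => mean (V x) fun y => ind (¬TV x y)) + 3 * g := by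
  have hu : ∀ _ : S, unif (Fin K) ∈ stdSimplex ℝ (Fin K) := fun _ => unif_mem
  set eV := mean pX (fun x => mean (V x) fun y => ind (¬TV x y)) + g with heV
  set e : (Fin M → A) → B → (S → Fin K) → ℝ := fun f b bin => mean (W (f w) b) fun s =>
    ind (Classical.epsilon (fun w' => ∃ s', bin s' = bin s ∧ T (f w') b s') ≠ w) with he
  have h1 : ∀ (f : Fin M → A) (h : Fin M' → B) (bin : S → Fin K),
      mean (piLaw fun _ : Fin K => pX) (fun word =>
        blockError W V f h bin word (hashDecoder T TV f h bin word) w v) ≤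
      eV + e f (h v) bin := fun f h bin => by
    unfold blockError
    rw [mean_comm, he, ← mean_const (hW (f w) (h v)) eV, ← mean_add]
    refine mean_mono (hW _ _).1 fun s => ?_
    refine le_trans ?_ (add_le_add_left
      (channel_random_coding hpX hV hK hg hTV (bin s)) _)
    rw [← mean_const (piLaw_mem fun _ : Fin K => hpX) (ind _), ← mean_add]
    refine mean_mono (piLaw_mem fun _ => hpX).1 fun word => ?_
    rw [← mean_const (hV (word (bin s))) (ind _), ← mean_add]
    refine mean_mono (hV _).1 fun y => ind_or_le fun hne => ?_
    by_contra! hcon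
    refine hne ?_
    unfold hashDecoder
    rw [hcon.1]
    exact hcon.2
  calc _ ≤ mean (piLaw fun _ : Fin M => pA) (fun f => mean (piLaw fun _ : Fin M' => pB) fun h =>
          mean (piLaw fun _ : S => unif (Fin K)) fun bin => eV + e f (h v) bin) :=
        mean_mono (piLaw_mem fun _ => hpA).1 fun f => mean_mono (piLaw_mem fun _ => hpB).1 fun h =>
          mean_mono (piLaw_mem hu).1 fun bin => h1 f h bin
    _ = eV + mean pB (fun b => mean (piLaw fun _ : Fin M => pA) fun f =>
          mean (piLaw fun _ : S => unif (Fin K)) fun bin => e f b bin) := by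
        simp only [mean_add, mean_const (piLaw_mem hu), mean_const (piLaw_mem fun _ : Fin M => hpA),
          mean_const (piLaw_mem fun _ : Fin M' => hpB)]
        -- The second codebook enters only through the codeword of `v`, which is side information at
        -- the decoder.
        rw [mean_comm, mean_piLaw_apply (fun _ => hpB) v fun b =>
          mean (piLaw fun _ : Fin M => pA) fun f =>
          mean (piLaw fun _ : S => unif (Fin K)) fun bin => e f b bin]
    _ ≤ eV + mean pB (fun b => mean pA (fun a => mean (W a b) fun s => ind (¬T a b s)) + 2 * g) := by
        gcongr
        refine mean_mono hpB.1 fun b => ?_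
        exact hash_random_coding hpA (fun a => hW a b) hM hκ hg (fun a s => hT a b s) w
    _ = _ := by
        rw [mean_add, mean_const hpB, mean_comm pB pA, heV]
        ring

theorem mean_comm₄ {α₁ α₂ α₃ α₄ β : Type*} [Fintype α₁] [Fintype α₂] [Fintype α₃] [Fintype α₄]
    [Fintype β] (p₁ : α₁ → ℝ) (p₂ : α₂ → ℝ) (p₃ : α₃ → ℝ) (p₄ : α₄ → ℝ) (q : β → ℝ)
    (F : α₁ → α₂ → α₃ → α₄ → β → ℝ) :
    mean p₁ (fun a => mean p₂ fun b => mean p₃ fun c => mean p₄ fun d => mean q fun w =>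
      F a b c d w) =
    mean q fun w => mean p₁ fun a => mean p₂ fun b => mean p₃ fun c => mean p₄ fun d =>
      F a b c d w := by
  rw [← mean_comm p₁ q]
  refine congrArg (mean p₁) (funext fun a => ?_)
  rw [← mean_comm p₂ q]
  refine congrArg (mean p₂) (funext fun b => ?_)
  rw [← mean_comm p₃ q]
  refine congrArg (mean p₃) (funext fun c => ?_)
  exact mean_comm p₄ q _

/-- Existence of a block code from the random coding bound. -/
theorem exists_block_code {pA : A → ℝ} (hpA : pA ∈ stdSimplex ℝ A) {pB : B → ℝ}
    (hpB : pB ∈ stdSimplex ℝ B) {pX : X → ℝ} (hpX : pX ∈ stdSimplex ℝ X)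
    {W : A → B → S → ℝ} (hW : ∀ a b, W a b ∈ stdSimplex ℝ S) {V : X → Y → ℝ}
    (hV : ∀ x, V x ∈ stdSimplex ℝ Y) {T₁ T₂ : A → B → S → Prop} {TV : X → Y → Prop}
    {M₁ M₂ K : ℕ} [NeZero M₁] [NeZero M₂] [NeZero K] {θ₁ θ₂ κ g : ℝ} (hM₁ : (M₁ : ℝ) - 1 ≤ θ₁)
    (hM₂ : (M₂ : ℝ) - 1 ≤ θ₂) (hK : (K : ℝ) - 1 ≤ κ) (hκ : κ ≤ K) (hg : 0 ≤ g)
    (hT₁ : ∀ a b s, T₁ a b s →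
      θ₁ * outLaw pA (fun a => W a b) s ≤ g * W a b s ∧ θ₁ ≤ g * κ * W a b s)
    (hT₂ : ∀ a b s, T₂ a b s →
      θ₂ * outLaw pB (W a) s ≤ g * W a b s ∧ θ₂ ≤ g * κ * W a b s)
    (hTV : ∀ x y, TV x y → κ * outLaw pX V y ≤ g * V x y) :
    ∃ (f : Fin M₁ → A) (h : Fin M₂ → B) (bin : S → Fin K) (word : Fin K → X)
      (dec₁ : Y → Fin M₁ → Fin M₂) (dec₂ : Y → Fin M₂ → Fin M₁),
      mean (unif (Fin M₁)) (fun w => mean (unif (Fin M₂)) fun v =>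
        blockError W V f h bin word dec₂ w v +
        blockError (fun b a => W a b) V h f bin word dec₁ v w) ≤
      mean pA (fun a => mean pB fun b => mean (W a b) fun s => ind (¬T₁ a b s)) +
      mean pA (fun a => mean pB fun b => mean (W a b) fun s => ind (¬T₂ a b s)) +
      2 * mean pX (fun x => mean (V x) fun y => ind (¬TV x y)) + 6 * g := by
  classical
  have hu : ∀ _ : S, unif (Fin K) ∈ stdSimplex ℝ (Fin K) := fun _ => unif_mem
  set F : (Fin M₁ → A) → (Fin M₂ → B) → (S → Fin K) → (Fin K → X) → Fin M₁ → Fin M₂ → ℝ :=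
    fun f h bin word w v =>
      blockError W V f h bin word (hashDecoder T₁ TV f h bin word) w v +
      blockError (fun b a => W a b) V h f bin word
        (hashDecoder (fun b a => T₂ a b) TV h f bin word) v w with hF
  set c := mean pA (fun a => mean pB fun b => mean (W a b) fun s => ind (¬T₁ a b s)) +
      mean pA (fun a => mean pB fun b => mean (W a b) fun s => ind (¬T₂ a b s)) +
      2 * mean pX (fun x => mean (V x) fun y => ind (¬TV x y)) + 6 * g with hc
  have key : ∀ w v, mean (piLaw fun _ : Fin M₁ => pA) (fun f =>
      mean (piLaw fun _ : Fin M₂ => pB) fun h => mean (piLaw fun _ : S => unif (Fin K)) fun bin =>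
        mean (piLaw fun _ : Fin K => pX) fun word => F f h bin word w v) ≤ c := fun w v => by
    have e1 := mean_blockError_le hpA hpB hpX hW hV hM₁ hK hκ hg hT₁ hTV w v
    have e2 := mean_blockError_le hpB hpA hpX (W := fun b a => W a b) (fun b a => hW a b) hV
      (T := fun b a => T₂ a b) hM₂ hK hκ hg (fun b a => hT₂ a b) hTV v w
    rw [mean_comm, mean_comm pB pA] at e2
    simp only [hF, mean_add]
    linarith
  have tot : mean (piLaw fun _ : Fin M₁ => pA) (fun f =>
      mean (piLaw fun _ : Fin M₂ => pB) fun h => mean (piLaw fun _ : S => unif (Fin K)) fun bin =>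
        mean (piLaw fun _ : Fin K => pX) fun word => mean (unif (Fin M₁)) fun w =>
          mean (unif (Fin M₂)) fun v => F f h bin word w v) ≤ c := by
    rw [mean_comm₄, ← mean_const (unif_mem (α := Fin M₁)) c]
    refine mean_mono unif_mem.1 fun w => ?_
    rw [mean_comm₄, ← mean_const (unif_mem (α := Fin M₂)) c]
    exact mean_mono unif_mem.1 fun v => key w v
  -- The errors of both nodes are averaged as one sum, so a single choice of codebooks, bins and
  -- words serves both.
  obtain ⟨f, hf⟩ := exists_le_of_mean_le (piLaw_mem fun _ => hpA) tot
  obtain ⟨h, hh⟩ := exists_le_of_mean_le (piLaw_mem fun _ => hpB) hf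
  obtain ⟨bin, hbin⟩ := exists_le_of_mean_le (piLaw_mem hu) hh
  obtain ⟨word, hword⟩ := exists_le_of_mean_le (piLaw_mem fun _ => hpX) hbin
  exact ⟨f, h, bin, word, _, _, hword⟩

end OneShot

end TwoWayRelay

namespace TwoWayRelay

open Finset Filter Topology

/-! Block codes for product channels. -/

section Block

theorem outLaw_piLaw {X Y : Type*} [Fintype X] {m : ℕ} (p : Fin m → X → ℝ) (V : Fin m → X → Y → ℝ) (y : Fin m → Y) :
    outLaw (piLaw p) (fun x => piLaw fun t => V t (x t)) y =
      ∏ t, outLaw (p t) (V t) (y t) :=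
  mean_piLaw_prod p fun t x => V t x (y t)

variable {X12 X21 YR XR Y : Type*}

/-- The memoryless extension of the uplink to words. -/
def uplinkWord {m : ℕ} (W : X12 → X21 → YR → ℝ) (a : Fin m → X12) (b : Fin m → X21) :
    (Fin m → YR) → ℝ :=
  piLaw fun t => W (a t) (b t)

/-- The memoryless extension of the downlink to words. -/
def downlinkWord {m : ℕ} (V : XR → Y → ℝ) (x : Fin m → XR) : (Fin m → Y) → ℝ :=
  piLaw fun t => V (x t)

variable [Fintype X12] [Fintype X21] [Fintype YR] [Fintype XR] [Fintype Y]

theorem uplinkLaw_mem {p12 : X12 → ℝ} (h12 : p12 ∈ stdSimplex ℝ X12) {p21 : X21 → ℝ}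
    (h21 : p21 ∈ stdSimplex ℝ X21) {W : X12 → X21 → YR → ℝ}
    (hW : ∀ a b, W a b ∈ stdSimplex ℝ YR) :
    uplinkLaw p12 p21 W ∈ stdSimplex ℝ (X12 × X21 × YR) := by
  refine ⟨fun ω => mul_nonneg (mul_nonneg (h12.1 _) (h21.1 _)) ((hW _ _).1 _), ?_⟩
  simp only [uplinkLaw, Fintype.sum_prod_type, ← mul_sum, (hW _ _).2, mul_one, h21.2, h12.2]

theorem jointLaw_mem {p : XR → ℝ} (hp : p ∈ stdSimplex ℝ XR) {V : XR → Y → ℝ}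
    (hV : ∀ x, V x ∈ stdSimplex ℝ Y) :
    (fun ω : XR × Y => p ω.1 * V ω.1 ω.2) ∈ stdSimplex ℝ (XR × Y) := by
  refine ⟨fun ω => mul_nonneg (hp.1 _) ((hV _).1 _), ?_⟩
  simp only [Fintype.sum_prod_type, ← mul_sum, (hV _).2, mul_one, hp.2]

theorem pos_of_uplinkLaw_pos {p12 : X12 → ℝ} (h12 : p12 ∈ stdSimplex ℝ X12) {p21 : X21 → ℝ}
    (h21 : p21 ∈ stdSimplex ℝ X21) {W : X12 → X21 → YR → ℝ} (hW : ∀ a b, W a b ∈ stdSimplex ℝ YR)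
    {ω : X12 × X21 × YR} (h : 0 < uplinkLaw p12 p21 W ω) :
    0 < p12 ω.1 ∧ 0 < p21 ω.2.1 ∧ 0 < W ω.1 ω.2.1 ω.2.2 := by
  unfold uplinkLaw at h
  refine ⟨(h12.1 _).lt_of_ne' ?_, (h21.1 _).lt_of_ne' ?_, ((hW _ _).1 _).lt_of_ne' ?_⟩ <;>
  · intro h0
    rw [h0] at h
    simp at h

theorem outLaw_pos {p : XR → ℝ} (hp : p ∈ stdSimplex ℝ XR) {V : XR → Y → ℝ}
    (hV : ∀ x, V x ∈ stdSimplex ℝ Y) {x : XR} {y : Y} (h1 : 0 < p x) (h2 : 0 < V x y) :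
    0 < outLaw p V y :=
  sum_pos' (fun x _ => mul_nonneg (hp.1 x) ((hV x).1 y)) ⟨x, mem_univ _, mul_pos h1 h2⟩

theorem mean_uplinkWord {m : ℕ} (p12 : Fin m → X12 → ℝ) (p21 : Fin m → X21 → ℝ)
    (W : X12 → X21 → YR → ℝ) (F : (Fin m → X12) → (Fin m → X21) → (Fin m → YR) → ℝ) :
    mean (piLaw p12) (fun a => mean (piLaw p21) fun b => mean (uplinkWord W a b) fun s =>
      F a b s) =
    mean (piLaw fun t => uplinkLaw (p12 t) (p21 t) W) fun ω =>
      F (fun t => (ω t).1) (fun t => (ω t).2.1) (fun t => (ω t).2.2) := by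
  have h1 : ∀ a : Fin m → X12, mean (piLaw p21) (fun b => mean (uplinkWord W a b) fun s =>
      F a b s) = mean (piLaw fun t (ω : X21 × YR) => p21 t ω.1 * W (a t) ω.1 ω.2) fun ω =>
        F a (fun t => (ω t).1) fun t => (ω t).2 := fun a =>
    mean_piLaw_bind p21 (fun t => W (a t)) (F a)
  simp only [h1]
  rw [mean_piLaw_bind p12 (fun t x (ω : X21 × YR) => p21 t ω.1 * W x ω.1 ω.2)
    fun a ω => F a (fun t => (ω t).1) fun t => (ω t).2]
  simp only [← mul_assoc]
  rfl

/-! ### Likelihood tests as tails of sums of information densities. -/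

theorem sum_logb_lt {m : ℕ} {f : Fin m → ℝ} (hf : ∀ t, 0 < f t) {c : ℝ} (h : ∏ t, f t < c) :
    ∑ t, Real.logb 2 (f t) < Real.logb 2 c := by
  rw [← Real.logb_prod univ f fun t _ => (hf t).ne']
  exact Real.logb_lt_logb (by norm_num) (prod_pos fun t _ => hf t) h

theorem uplink_atypical_le {m : ℕ} {p12 : Fin m → X12 → ℝ} (h12 : ∀ t, p12 t ∈ stdSimplex ℝ X12)
    {p21 : Fin m → X21 → ℝ} (h21 : ∀ t, p21 t ∈ stdSimplex ℝ X21) {W : X12 → X21 → YR → ℝ}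
    (hW : ∀ a b, W a b ∈ stdSimplex ℝ YR) {Q : Fin m → X12 × X21 × YR → ℝ}
    (hQ : ∀ t ω, 0 < uplinkLaw (p12 t) (p21 t) W ω → 0 < Q t ω) {θ κ g : ℝ}
    (hκ : 0 < κ) (hg : 0 < g) :
    mean (piLaw p12) (fun a => mean (piLaw p21) fun b => mean (uplinkWord W a b) fun s =>
      ind (¬(θ * ∏ t, Q t (a t, b t, s t) ≤ g * uplinkWord W a b s ∧
        θ ≤ g * κ * uplinkWord W a b s))) ≤
    mean (piLaw fun t => uplinkLaw (p12 t) (p21 t) W) (fun ω =>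
      ind (∑ t, Real.logb 2 (W (ω t).1 (ω t).2.1 (ω t).2.2 / Q t (ω t)) < Real.logb 2 (θ / g))) +
    mean (piLaw fun t => uplinkLaw (p12 t) (p21 t) W) (fun ω =>
      ind (∑ t, Real.logb 2 (W (ω t).1 (ω t).2.1 (ω t).2.2) < Real.logb 2 (θ / (g * κ)))) := by
  have hL := fun t => uplinkLaw_mem (h12 t) (h21 t) hW
  rw [mean_uplinkWord, ← mean_add]
  -- Outcomes of probability zero are discarded, so every factor is positive and the logarithm of
  -- the product is the sum of the logarithms.
  refine mean_mono_of_support (piLaw_mem hL).1 fun ω hω => ind_or_le fun hn => ?_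
  have hpos := fun t => pos_of_piLaw_pos (fun t => (hL t).1) hω t
  have hWp := fun t => (pos_of_uplinkLaw_pos (h12 t) (h21 t) hW (hpos t)).2.2
  have hQp := fun t => hQ t _ (hpos t)
  rw [not_and_or, not_le, not_le] at hn
  refine hn.imp (fun h => sum_logb_lt (fun t => div_pos (hWp t) (hQp t)) ?_)
    fun h => sum_logb_lt hWp ?_
  · rw [prod_div_distrib, div_lt_div_iff₀ (prod_pos fun t _ => hQp t) hg, mul_comm]
    exact h
  · rw [lt_div_iff₀ (mul_pos hg hκ), mul_comm]
    exact h

theorem downlink_atypical_le {m : ℕ} {p : Fin m → XR → ℝ} (hp : ∀ t, p t ∈ stdSimplex ℝ XR)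
    {V : XR → Y → ℝ} (hV : ∀ x, V x ∈ stdSimplex ℝ Y) {κ g : ℝ} (hg : 0 < g) :
    mean (piLaw p) (fun x => mean (downlinkWord V x) fun y =>
      ind (¬(κ * ∏ t, outLaw (p t) V (y t) ≤ g * downlinkWord V x y))) ≤
    mean (piLaw fun t (ω : XR × Y) => p t ω.1 * V ω.1 ω.2) (fun ω =>
      ind (∑ t, Real.logb 2 (V (ω t).1 (ω t).2 / outLaw (p t) V (ω t).2) <
        Real.logb 2 (κ / g))) := by
  have hL := fun t => jointLaw_mem (hp t) hV
  unfold downlinkWord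
  rw [mean_piLaw_bind p (fun _ => V) fun x y =>
      ind (¬(κ * ∏ t, outLaw (p t) V (y t) ≤ g * piLaw (fun t => V (x t)) y))]
  refine mean_mono_of_support (piLaw_mem hL).1 fun ω hω => ind_mono fun hn => ?_
  have hpos := fun t => pos_of_piLaw_pos (fun t => (hL t).1) hω t
  have hp0 : ∀ t, 0 < p t (ω t).1 := fun t => pos_of_mul_pos_left (hpos t) ((hV _).1 _)
  have hV0 : ∀ t, 0 < V (ω t).1 (ω t).2 := fun t => pos_of_mul_pos_right (hpos t) ((hp t).1 _)
  have hQ := fun t => outLaw_pos (hp t) hV (hp0 t) (hV0 t)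
  refine sum_logb_lt (fun t => div_pos (hV0 t) (hQ t)) ?_
  rw [prod_div_distrib, div_lt_div_iff₀ (prod_pos fun t _ => hQ t) hg, mul_comm]
  exact not_le.1 hn

/-- A uniform weak law of large numbers for independent variables of finitely many types. -/
theorem eventually_tail_le {ι α : Type*} [Fintype ι] [Fintype α] {P : ι → α → ℝ}
    (hP : ∀ i, P i ∈ stdSimplex ℝ α) (h : ι → α → ℝ) {δ η : ℝ} (hδ : 0 < δ) (hη : 0 < η) :
    ∀ᶠ m : ℕ in atTop, ∀ (σ : Fin m → ι) (c : ℝ), c ≤ ∑ t, mean (P (σ t)) (h (σ t)) - m * δ →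
      mean (piLaw fun t => P (σ t)) (fun f => ind (∑ t, h (σ t) (f t) < c)) ≤ η := by
  set v : ι → ℝ := fun i => mean (P i) fun a => (h i a - mean (P i) (h i)) ^ 2 with hv
  have hv0 : ∀ i, 0 ≤ v i := fun i => mean_nonneg (hP i).1 fun a => sq_nonneg _
  have hlim : Tendsto (fun m : ℕ => (∑ i, v i) / δ ^ 2 / (m : ℝ)) atTop (𝓝 0) :=
    tendsto_const_div_atTop_nhds_zero_nat _
  filter_upwards [hlim.eventually_le_const hη, eventually_gt_atTop 0] with m hm hm0 σ c hc
  have hm0' : (0 : ℝ) < m := by exact_mod_cast hm0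
  calc _ ≤ mean (piLaw fun t => P (σ t)) (fun f => ind (∑ t, h (σ t) (f t) <
          ∑ t, mean (P (σ t)) (h (σ t)) - m * δ)) :=
        mean_mono (piLaw_mem fun t => hP _).1 fun f => ind_mono fun hlt => hlt.trans_le hc
    _ ≤ (∑ t, v (σ t)) / (m * δ) ^ 2 :=
        chebyshev_lower (fun t => hP (σ t)) (fun t => h (σ t)) (by positivity)
    _ ≤ (∑ _t : Fin m, ∑ i, v i) / (m * δ) ^ 2 := by
        -- Each variance is bounded by the sum over all types, which makes the threshold for `m`
        -- independent of `σ`.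
        gcongr with t _
        exact single_le_sum (f := v) (fun i _ => hv0 i) (mem_univ _)
    _ = (∑ i, v i) / δ ^ 2 / m := by
        rw [sum_const, card_univ, Fintype.card_fin, nsmul_eq_mul]
        field_simp
    _ ≤ η := hm

/-- Block codes for hash-and-forward: position `t` of the block uses the input laws of type
`σ t`. -/
theorem eventually_exists_block_code {ι : Type*} [Fintype ι] {p12 : ι → X12 → ℝ}
    (h12 : ∀ i, p12 i ∈ stdSimplex ℝ X12) {p21 : ι → X21 → ℝ} (h21 : ∀ i, p21 i ∈ stdSimplex ℝ X21)
    {pR : ι → XR → ℝ} (hR : ∀ i, pR i ∈ stdSimplex ℝ XR) {W : X12 → X21 → YR → ℝ}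
    (hW : ∀ a b, W a b ∈ stdSimplex ℝ YR) {V : XR → Y → ℝ} (hV : ∀ x, V x ∈ stdSimplex ℝ Y)
    {I₁ I₂ H C : ι → ℝ}
    (hI₁ : ∀ i, I₁ i = mean (uplinkLaw (p12 i) (p21 i) W) fun ω => Real.logb 2
      (W ω.1 ω.2.1 ω.2.2 / outLaw (p12 i) (fun a => W a ω.2.1) ω.2.2))
    (hI₂ : ∀ i, I₂ i = mean (uplinkLaw (p12 i) (p21 i) W) fun ω => Real.logb 2
      (W ω.1 ω.2.1 ω.2.2 / outLaw (p21 i) (W ω.1) ω.2.2))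
    (hH : ∀ i, -H i = mean (uplinkLaw (p12 i) (p21 i) W) fun ω => Real.logb 2
      (W ω.1 ω.2.1 ω.2.2))
    (hC : ∀ i, C i = mean (fun ω : XR × Y => pR i ω.1 * V ω.1 ω.2) fun ω => Real.logb 2
      (V ω.1 ω.2 / outLaw (pR i) V ω.2))
    (h₁ : ∀ i, I₁ i + H i ≤ C i) (h₂ : ∀ i, I₂ i + H i ≤ C i) {δ : ℝ} (hδ : 0 < δ) :
    ∀ᶠ m : ℕ in atTop, ∀ σ : Fin m → ι, ∃ (M₁ M₂ K : ℕ) (f : Fin M₁ → Fin m → X12)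
      (h : Fin M₂ → Fin m → X21) (bin : (Fin m → YR) → Fin K) (word : Fin K → Fin m → XR)
      (dec₁ : (Fin m → Y) → Fin M₁ → Fin M₂) (dec₂ : (Fin m → Y) → Fin M₂ → Fin M₁),
      (2 : ℝ) ^ (∑ t, I₁ (σ t) - 4 * (m * δ)) ≤ M₁ ∧
      (2 : ℝ) ^ (∑ t, I₂ (σ t) - 4 * (m * δ)) ≤ M₂ ∧
      mean (unif (Fin M₁)) (fun w => mean (unif (Fin M₂)) fun v =>
        blockError (uplinkWord W) (downlinkWord V) f h bin word dec₂ w v +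
        blockError (fun b a => uplinkWord W a b) (downlinkWord V) h f bin word dec₁ v w) ≤ δ := by
  have hL := fun i => uplinkLaw_mem (h12 i) (h21 i) hW
  -- Error budget: four uplink tails, twice the downlink tail and `6 * g` make twelve terms.
  have hη : 0 < δ / 12 := by positivity
  have hgl : Tendsto (fun m : ℕ => ((2 : ℝ) ^ (-δ)) ^ m) atTop (𝓝 0) :=
    tendsto_pow_atTop_nhds_zero_of_lt_one (by positivity)
      (Real.rpow_lt_one_of_one_lt_of_neg (by norm_num) (by linarith))
  filter_upwards [eventually_tail_le hL (fun i ω => Real.logb 2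
      (W ω.1 ω.2.1 ω.2.2 / outLaw (p12 i) (fun a => W a ω.2.1) ω.2.2)) hδ hη,
    eventually_tail_le hL (fun i ω => Real.logb 2
      (W ω.1 ω.2.1 ω.2.2 / outLaw (p21 i) (W ω.1) ω.2.2)) hδ hη,
    eventually_tail_le hL (fun i ω => Real.logb 2 (W ω.1 ω.2.1 ω.2.2)) hδ hη,
    eventually_tail_le (fun i => jointLaw_mem (hR i) hV) (fun i ω => Real.logb 2
      (V ω.1 ω.2 / outLaw (pR i) V ω.2)) hδ hη,
    hgl.eventually_le_const hη] with m t₁ t₂ tH tC hgm σ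
  simp only [← hI₁] at t₁
  simp only [← hI₂] at t₂
  simp only [← hH] at tH
  simp only [← hC] at tC
  have hmδ : 0 ≤ m * δ := by positivity
  -- In units of `m * δ`: `g` costs 1. The downlink tail for `κ / g` needs slack 1, so `κ` gives up
  -- 2. The tail for `θ₁ / (g * κ)` also needs slack 1, so `θ₁` gives up 2 + 1 + 1 = 4.
  set θ₁ : ℝ := 2 ^ (∑ t, I₁ (σ t) - 4 * (m * δ)) with hθ₁
  set θ₂ : ℝ := 2 ^ (∑ t, I₂ (σ t) - 4 * (m * δ)) with hθ₂
  set κ : ℝ := 2 ^ (∑ t, C (σ t) - 2 * (m * δ)) with hκ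
  set g : ℝ := 2 ^ (-(m * δ)) with hg
  have hg12 : g ≤ δ / 12 := by
    refine le_of_eq_of_le ?_ hgm
    rw [hg, ← Real.rpow_mul_natCast (by norm_num)]
    congr 1; ring
  have hg0 : 0 < g := by positivity
  have hκ0 : 0 < κ := by positivity
  have hceil : ∀ x : ℝ, 0 < x → ((⌈x⌉₊ : ℕ) : ℝ) - 1 ≤ x := fun x hx => by
    linarith [Nat.ceil_lt_add_one hx.le]
  have : NeZero ⌈θ₁⌉₊ := ⟨(Nat.ceil_pos.2 (by positivity)).ne'⟩
  have : NeZero ⌈θ₂⌉₊ := ⟨(Nat.ceil_pos.2 (by positivity)).ne'⟩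
  have : NeZero ⌈κ⌉₊ := ⟨(Nat.ceil_pos.2 hκ0).ne'⟩
  have lg : ∀ a b : ℝ, Real.logb 2 ((2 : ℝ) ^ a / 2 ^ b) = a - b := fun a b => by
    rw [← Real.rpow_sub (by norm_num), Real.logb_rpow (by norm_num) (by norm_num)]
  have hgκ : g * κ = 2 ^ (∑ t, C (σ t) - 3 * (m * δ)) := by
    rw [hg, hκ, ← Real.rpow_add (by norm_num)]; congr 1; ring
  have s₁ : ∑ t, I₁ (σ t) + ∑ t, H (σ t) ≤ ∑ t, C (σ t) := by
    rw [← sum_add_distrib]; exact sum_le_sum fun t _ => h₁ _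
  have s₂ : ∑ t, I₂ (σ t) + ∑ t, H (σ t) ≤ ∑ t, C (σ t) := by
    rw [← sum_add_distrib]; exact sum_le_sum fun t _ => h₂ _
  have hWm : ∀ (a : Fin m → X12) (b : Fin m → X21), uplinkWord W a b ∈ stdSimplex ℝ _ :=
    fun a b => piLaw_mem fun t => hW _ _
  have hVm : ∀ x : Fin m → XR, downlinkWord V x ∈ stdSimplex ℝ _ := fun x => piLaw_mem fun t => hV _
  obtain ⟨f, h, bin, word, dec₁, dec₂, hcode⟩ := exists_block_code
    (piLaw_mem fun t => h12 (σ t)) (piLaw_mem fun t => h21 (σ t)) (piLaw_mem fun t => hR (σ t))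
    hWm hVm
    (T₁ := fun a b s => θ₁ * ∏ t, outLaw (p12 (σ t)) (fun x => W x (b t)) (s t) ≤
        g * uplinkWord W a b s ∧ θ₁ ≤ g * κ * uplinkWord W a b s)
    (T₂ := fun a b s => θ₂ * ∏ t, outLaw (p21 (σ t)) (W (a t)) (s t) ≤
        g * uplinkWord W a b s ∧ θ₂ ≤ g * κ * uplinkWord W a b s)
    (TV := fun x y => κ * ∏ t, outLaw (pR (σ t)) V (y t) ≤ g * downlinkWord V x y)
    (hceil θ₁ (by positivity)) (hceil θ₂ (by positivity)) (hceil κ hκ0) (Nat.le_ceil κ) hg0.le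
    (fun a b s hT => by
      refine ⟨le_of_eq_of_le ?_ hT.1, hT.2⟩
      exact congrArg (θ₁ * ·) (outLaw_piLaw (fun t => p12 (σ t)) (fun t x => W x (b t)) s))
    (fun a b s hT => by
      refine ⟨le_of_eq_of_le ?_ hT.1, hT.2⟩
      exact congrArg (θ₂ * ·) (outLaw_piLaw (fun t => p21 (σ t)) (fun t => W (a t)) s))
    (fun x y hT => by
      refine le_of_eq_of_le ?_ hT
      exact congrArg (κ * ·) (outLaw_piLaw (fun t => pR (σ t)) (fun _ => V) y))
  refine ⟨_, _, _, f, h, bin, word, dec₁, dec₂, Nat.le_ceil _, Nat.le_ceil _, hcode.trans ?_⟩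
  have b₁ := uplink_atypical_le (fun t => h12 (σ t)) (fun t => h21 (σ t)) hW
    (Q := fun t ω => outLaw (p12 (σ t)) (fun x => W x ω.2.1) ω.2.2)
    (fun t ω hω => by
      have := pos_of_uplinkLaw_pos (h12 _) (h21 _) hW hω
      exact outLaw_pos (h12 _) (fun a => hW a _) this.1 this.2.2) (θ := θ₁) hκ0 hg0
  have b₂ := uplink_atypical_le (fun t => h12 (σ t)) (fun t => h21 (σ t)) hW
    (Q := fun t ω => outLaw (p21 (σ t)) (W ω.1) ω.2.2)
    (fun t ω hω => by
      have := pos_of_uplinkLaw_pos (h12 _) (h21 _) hW hω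
      exact outLaw_pos (h21 _) (fun b => hW _ b) this.2.1 this.2.2) (θ := θ₂) hκ0 hg0
  have bC := downlink_atypical_le (fun t => hR (σ t)) hV (κ := κ) hg0
  rw [hgκ, hθ₁, hg, lg, lg] at b₁
  rw [hgκ, hθ₂, hg, lg, lg] at b₂
  rw [hκ, hg, lg] at bC
  have hnH : ∑ t, -H (σ t) = -∑ t, H (σ t) := sum_neg_distrib _
  have u₁ := t₁ σ _ (show ∑ t, I₁ (σ t) - 4 * (m * δ) - -(m * δ) ≤ _ by linarith)
  have u₂ := t₂ σ _ (show ∑ t, I₂ (σ t) - 4 * (m * δ) - -(m * δ) ≤ _ by linarith)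
  -- Here `I + H ≤ C` is needed: the compatible words have to be spread thinly over the bins.
  have v₁ := tH σ (∑ t, I₁ (σ t) - 4 * (m * δ) - (∑ t, C (σ t) - 3 * (m * δ)))
    (by rw [hnH]; linarith)
  have v₂ := tH σ (∑ t, I₂ (σ t) - 4 * (m * δ) - (∑ t, C (σ t) - 3 * (m * δ)))
    (by rw [hnH]; linarith)
  have uC := tC σ _ (show ∑ t, C (σ t) - 2 * (m * δ) - -(m * δ) ≤ _ by linarith)
  rw [← hg] at b₁ b₂ bC
  rw [← hθ₁, hgκ] at *
  linarith

end Block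

end TwoWayRelay

namespace TwoWayRelay

open Finset

/-! Evaluation of the information measures. -/

section Info

variable {X12 X21 YR XR Y : Type*}

theorem law_of_injective {Ω α : Type*} [Fintype Ω] (p : Ω → ℝ) {X : Ω → α}
    (hX : Function.Injective X) (ω : Ω) : law p X (X ω) = p ω := by
  classical
  simp [law, hX.eq_iff]

section Uplink

variable [Fintype X12] [Fintype X21] [Fintype YR] {p12 : X12 → ℝ} {p21 : X21 → ℝ}
  {W : X12 → X21 → YR → ℝ}

theorem law_uplink_input12 (h21 : p21 ∈ stdSimplex ℝ X21) (hW : ∀ a b, W a b ∈ stdSimplex ℝ YR)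
    (a : X12) : law (uplinkLaw p12 p21 W) (fun ω => ω.1) a = p12 a := by
  classical
  simp [law, uplinkLaw, Fintype.sum_prod_type, ← mul_sum, (hW _ _).2, h21.2]

theorem law_uplink_input21 (h12 : p12 ∈ stdSimplex ℝ X12) (hW : ∀ a b, W a b ∈ stdSimplex ℝ YR)
    (b : X21) : law (uplinkLaw p12 p21 W) (fun ω => ω.2.1) b = p21 b := by
  classical
  simp [law, uplinkLaw, Fintype.sum_prod_type, ← mul_sum, (hW _ _).2, ← sum_mul, h12.2]

theorem law_uplink_inputs (hW : ∀ a b, W a b ∈ stdSimplex ℝ YR) (a : X12) (b : X21) :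
    law (uplinkLaw p12 p21 W) (fun ω => (ω.1, ω.2.1)) (a, b) = p12 a * p21 b := by
  classical
  simp [law, uplinkLaw, Fintype.sum_prod_type, Prod.mk.injEq, ite_and, ← mul_sum, (hW _ _).2]

theorem law_uplink_inputs_swap (hW : ∀ a b, W a b ∈ stdSimplex ℝ YR) (a : X12) (b : X21) :
    law (uplinkLaw p12 p21 W) (fun ω => (ω.2.1, ω.1)) (b, a) = p12 a * p21 b := by
  rw [← law_uplink_inputs hW]
  refine sum_congr rfl fun ω _ => ?_
  have : (ω.2.1, ω.1) = (b, a) ↔ (ω.1, ω.2.1) = (a, b) := by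
    simp only [Prod.mk.injEq, and_comm]
  by_cases h : (ω.1, ω.2.1) = (a, b)
  · rw [if_pos h, if_pos (this.2 h)]
  · rw [if_neg h, if_neg (mt this.1 h)]

theorem law_uplink_output21 (b : X21) (y : YR) :
    law (uplinkLaw p12 p21 W) (fun ω => (ω.2.2, ω.2.1)) (y, b) =
      p21 b * outLaw p12 (fun a => W a b) y := by
  classical
  simp only [law, uplinkLaw, Fintype.sum_prod_type, Prod.mk.injEq, ite_and, sum_ite_eq',
    mem_univ, if_true, outLaw, mean, mul_sum]
  exact sum_congr rfl fun a _ => by ring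

theorem law_uplink_output12 (a : X12) (y : YR) :
    law (uplinkLaw p12 p21 W) (fun ω => (ω.2.2, ω.1)) (y, a) = p12 a * outLaw p21 (W a) y := by
  classical
  simp only [law, uplinkLaw, Fintype.sum_prod_type, Prod.mk.injEq, ite_and, sum_ite_eq',
    mem_univ, if_true, outLaw, mean, mul_sum]
  rw [sum_eq_single a (fun a' _ ha => by simp [ha]) (by simp)]
  refine sum_congr rfl fun b _ => ?_
  simp; ring

variable (h12 : p12 ∈ stdSimplex ℝ X12) (h21 : p21 ∈ stdSimplex ℝ X21)
  (hW : ∀ a b, W a b ∈ stdSimplex ℝ YR)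

include h12 h21 hW

/-- On the support the input probabilities cancel, leaving the information density to which the law
of large numbers is applied. -/
theorem uplinkInfo12_eq : uplinkInfo12 p12 p21 W = mean (uplinkLaw p12 p21 W) fun ω =>
    Real.logb 2 (W ω.1 ω.2.1 ω.2.2 / outLaw p12 (fun a => W a ω.2.1) ω.2.2) := by
  refine mean_congr_of_support (uplinkLaw_mem h12 h21 hW).1 fun ω hω => ?_
  obtain ⟨ha, hb, hw⟩ := pos_of_uplinkLaw_pos h12 h21 hW hω
  rw [law_of_injective (X := fun ω : X12 × X21 × YR => (ω.1, ω.2.2, ω.2.1)) _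
      (fun _ _ h => by simp only [Prod.ext_iff] at h ⊢; tauto),
    law_uplink_input21 h12 hW, law_uplink_inputs hW, law_uplink_output21, uplinkLaw]
  congr 1
  have := outLaw_pos h12 (fun a => hW a ω.2.1) ha hw
  field_simp

theorem uplinkInfo21_eq : uplinkInfo21 p12 p21 W = mean (uplinkLaw p12 p21 W) fun ω =>
    Real.logb 2 (W ω.1 ω.2.1 ω.2.2 / outLaw p21 (W ω.1) ω.2.2) := by
  refine mean_congr_of_support (uplinkLaw_mem h12 h21 hW).1 fun ω hω => ?_
  obtain ⟨ha, hb, hw⟩ := pos_of_uplinkLaw_pos h12 h21 hW hω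
  rw [law_of_injective (X := fun ω : X12 × X21 × YR => (ω.2.1, ω.2.2, ω.1)) _
      (fun _ _ h => by simp only [Prod.ext_iff] at h ⊢; tauto),
    law_uplink_input12 h21 hW, law_uplink_inputs_swap hW, law_uplink_output12, uplinkLaw]
  congr 1
  have := outLaw_pos h21 (fun b => hW ω.1 b) hb hw
  field_simp

theorem neg_relayEntropyGivenBoth_eq : -relayEntropyGivenBoth p12 p21 W =
    mean (uplinkLaw p12 p21 W) fun ω => Real.logb 2 (W ω.1 ω.2.1 ω.2.2) := by
  rw [neg_eq_iff_eq_neg, ← neg_one_mul, ← mean_mul_left]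
  refine mean_congr_of_support (uplinkLaw_mem h12 h21 hW).1 fun ω hω => ?_
  obtain ⟨ha, hb, hw⟩ := pos_of_uplinkLaw_pos h12 h21 hW hω
  rw [law_of_injective (X := fun ω : X12 × X21 × YR => (ω.2.2, ω.1, ω.2.1)) _
      (fun _ _ h => by simp only [Prod.ext_iff] at h ⊢; tauto),
    law_uplink_inputs hW, uplinkLaw, neg_one_mul, ← Real.logb_inv]
  congr 1
  field_simp

/-- Chain rule, checked pointwise on the information densities. It turns the strong downlink
condition into `I + H ≤ C`. -/
theorem uplinkInfo12_add_relayEntropyGivenBoth :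
    uplinkInfo12 p12 p21 W + relayEntropyGivenBoth p12 p21 W = relayEntropyGiven21 p12 p21 W := by
  rw [← sub_neg_eq_add, neg_relayEntropyGivenBoth_eq h12 h21 hW, uplinkInfo12_eq h12 h21 hW,
    ← mean_sub]
  refine mean_congr_of_support (uplinkLaw_mem h12 h21 hW).1 fun ω hω => ?_
  obtain ⟨ha, hb, hw⟩ := pos_of_uplinkLaw_pos h12 h21 hW hω
  have := outLaw_pos h12 (fun a => hW a ω.2.1) ha hw
  rw [law_uplink_input21 h12 hW, law_uplink_output21, ← Real.logb_div (by positivity) (by positivity)]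
  congr 1
  field_simp

theorem uplinkInfo21_add_relayEntropyGivenBoth :
    uplinkInfo21 p12 p21 W + relayEntropyGivenBoth p12 p21 W = relayEntropyGiven12 p12 p21 W := by
  rw [← sub_neg_eq_add, neg_relayEntropyGivenBoth_eq h12 h21 hW, uplinkInfo21_eq h12 h21 hW,
    ← mean_sub]
  refine mean_congr_of_support (uplinkLaw_mem h12 h21 hW).1 fun ω hω => ?_
  obtain ⟨ha, hb, hw⟩ := pos_of_uplinkLaw_pos h12 h21 hW hω
  have := outLaw_pos h21 (fun b => hW ω.1 b) hb hw
  rw [law_uplink_input12 h21 hW, law_uplink_output12, ← Real.logb_div (by positivity) (by positivity)]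
  congr 1
  field_simp

end Uplink

section Downlink

variable [Fintype XR] [Fintype Y]

theorem channelInfo_eq {p : XR → ℝ} (hp : p ∈ stdSimplex ℝ XR) {V : XR → Y → ℝ}
    (hV : ∀ x, V x ∈ stdSimplex ℝ Y) :
    channelInfo p V = mean (fun ω : XR × Y => p ω.1 * V ω.1 ω.2) fun ω =>
      Real.logb 2 (V ω.1 ω.2 / outLaw p V ω.2) := by
  classical
  refine mean_congr_of_support (jointLaw_mem hp hV).1 fun ω hω => ?_
  have hp0 : 0 < p ω.1 := pos_of_mul_pos_left hω ((hV _).1 _)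
  rw [law_of_injective (X := fun ω : XR × Y => (ω.1, ω.2)) _ fun _ _ h => h]
  have h1 : law (fun ω : XR × Y => p ω.1 * V ω.1 ω.2) (fun ω => ω.1) ω.1 = p ω.1 := by
    simp [law, Fintype.sum_prod_type, ← mul_sum, (hV _).2]
  have h2 : law (fun ω : XR × Y => p ω.1 * V ω.1 ω.2) (fun ω => ω.2) ω.2 = outLaw p V ω.2 := by
    simp [law, Fintype.sum_prod_type, outLaw, mean]
  rw [h1, h2, mul_div_mul_left _ _ hp0.ne']

variable {U : Type*} [Fintype U] {p : XR → ℝ} {φ : U ≃ XR} {q : U × XR → ℝ} {V : XR → Y → ℝ}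

/-- The bijection `φ` covers both copies of `U = X_R` in use: `XR` itself, as in `diagLaw`, and an
alphabet `Fin k`, as in `hfRatesAt`. -/
theorem sum_downlinkLaw [DecidableEq XR] (hq : ∀ u x, q (u, x) = if φ u = x then p x else 0)
    (F : U × XR × Y × Y → ℝ) :
    ∑ ω, downlinkLaw q V V ω * F ω =
      ∑ x, ∑ y, ∑ z, p x * V x y * V x z * F (φ.symm x, x, y, z) := by
  simp only [downlinkLaw, Fintype.sum_prod_type, hq]
  rw [sum_comm]
  refine sum_congr rfl fun x _ => ?_
  rw [sum_eq_single (φ.symm x)]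
  · simp
  · intro u _ hu
    have : φ u ≠ x := fun h => hu (by rw [← h, φ.symm_apply_apply])
    simp [this]
  · simp

theorem law_downlinkLaw [DecidableEq XR] (hq : ∀ u x, q (u, x) = if φ u = x then p x else 0)
    {α : Type*} (Z : U × XR × Y × Y → α) (a : α) :
    law (downlinkLaw q V V) Z a =
      ∑ x, ∑ y, ∑ z, p x * V x y * V x z * ind (Z (φ.symm x, x, y, z) = a) := by
  rw [← sum_downlinkLaw hq fun ω => ind (Z ω = a)]
  simp [law, ind]

theorem downlinkRate2_diag [DecidableEq XR] (hp : p ∈ stdSimplex ℝ XR)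
    (hV : ∀ x, V x ∈ stdSimplex ℝ Y) (hq : ∀ u x, q (u, x) = if φ u = x then p x else 0) :
    downlinkRate2 q V V = channelInfo p V := by
  classical
  unfold downlinkRate2 mutualInfo
  rw [sum_downlinkLaw hq, channelInfo_eq hp hV, mean, Fintype.sum_prod_type]
  refine sum_congr rfl fun x _ => ?_
  rw [sum_comm]
  refine sum_congr rfl fun z _ => ?_
  have h1 : law (downlinkLaw q V V) (fun ω => ω.1) (φ.symm x) = p x := by
    simp [law_downlinkLaw hq, ind, ← mul_sum, (hV _).2]
  have h2 : law (downlinkLaw q V V) (fun ω => ω.2.2.2) z = outLaw p V z := by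
    simp [law_downlinkLaw hq, ind, outLaw, mean, ← mul_sum, ← sum_mul, (hV _).2]
  have h3 : law (downlinkLaw q V V) (fun ω => (ω.1, ω.2.2.2)) (φ.symm x, z) = p x * V x z := by
    simp [law_downlinkLaw hq, ind, ite_and, ← mul_sum, ← sum_mul, (hV _).2]
  simp only [h1, h2, h3]
  rw [← sum_mul, ← sum_mul, ← mul_sum, (hV x).2, mul_one]
  rcases (hp.1 x).eq_or_lt with h0 | h0
  · simp [← h0]
  · rw [mul_div_mul_left _ _ h0.ne']

/-- Given `U` the relay input is deterministic, so every logarithm of positive weight is `logb 2 1`.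
-/
theorem condMutualInfo_diag [DecidableEq XR] (hV : ∀ x, V x ∈ stdSimplex ℝ Y)
    (hq : ∀ u x, q (u, x) = if φ u = x then p x else 0) :
    condMutualInfo (downlinkLaw q V V) (fun ω => ω.2.1) (fun ω => ω.2.2.1) (fun ω => ω.1) = 0 := by
  classical
  unfold condMutualInfo
  rw [sum_downlinkLaw hq]
  refine sum_eq_zero fun x _ => sum_eq_zero fun y _ => sum_eq_zero fun z _ => ?_
  have h1 : law (downlinkLaw q V V) (fun ω => ω.1) (φ.symm x) = p x := by
    simp [law_downlinkLaw hq, ind, ← mul_sum, (hV _).2]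
  have h2 : law (downlinkLaw q V V) (fun ω => (ω.2.1, ω.1)) (x, φ.symm x) = p x := by
    simp [law_downlinkLaw hq, ind, ← mul_sum, (hV _).2]
  have h3 : law (downlinkLaw q V V) (fun ω => (ω.2.2.1, ω.1)) (y, φ.symm x) = p x * V x y := by
    simp only [law_downlinkLaw hq, Prod.mk.injEq, φ.symm.injective.eq_iff]
    rw [sum_eq_single x (fun x' _ h => by simp [h, ind]) (by simp),
      sum_eq_single y (fun x' _ h => by simp [h, ind]) (by simp)]
    simp [ind, ← mul_sum, (hV _).2]
  have h4 : law (downlinkLaw q V V) (fun ω => (ω.2.1, ω.2.2.1, ω.1)) (x, y, φ.symm x) =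
      p x * V x y := by
    simp only [law_downlinkLaw hq, Prod.mk.injEq, φ.symm.injective.eq_iff]
    rw [sum_eq_single x (fun x' _ h => by simp [h, ind]) (by simp),
      sum_eq_single y (fun x' _ h => by simp [h, ind]) (by simp)]
    simp [ind, ← mul_sum, (hV _).2]
  simp only [h1, h2, h3, h4]
  rcases eq_or_ne (p x) 0 with h0 | h0
  · simp [h0]
  rcases eq_or_ne (V x y) 0 with h0' | h0'
  · simp [h0']
  · rw [mul_comm (p x) (p x * V x y), div_self (by positivity), Real.logb_one, mul_zero]

theorem downlinkRate1_diag [DecidableEq XR] (hp : p ∈ stdSimplex ℝ XR)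
    (hV : ∀ x, V x ∈ stdSimplex ℝ Y) (hq : ∀ u x, q (u, x) = if φ u = x then p x else 0) :
    downlinkRate1 q V V = channelInfo p V := by
  rw [downlinkRate1, condMutualInfo_diag hV hq, zero_add, downlinkRate2_diag hp hV hq]

end Downlink

end Info

end TwoWayRelay

namespace TwoWayRelay

open Finset

/-! Concatenation of blocks into a code. -/

section BlockCode

variable {X12 X21 YR XR Y : Type*} {n m B M₁ M₂ K : ℕ}

/-- The time of position `t` in block `b`. -/
def blockTime (hn : (B + 1) * m ≤ n) (b : Fin (B + 1)) (t : Fin m) : Fin n :=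
  ⟨b * m + t, by
    have h1 : ((b : ℕ) + 1) * m ≤ (B + 1) * m := Nat.mul_le_mul_right m b.isLt
    have h2 := t.isLt
    rw [Nat.succ_mul] at h1
    omega⟩

theorem blockTime_injective (hn : (B + 1) * m ≤ n) (b : Fin (B + 1)) :
    Function.Injective (blockTime hn b) := fun t t' h => by
  simp only [blockTime, Fin.mk.injEq] at h
  exact Fin.ext (by omega)

theorem mul_add_div_eq (b : ℕ) (t : Fin m) : (b * m + t) / m = b := by
  have := t.isLt
  rw [Nat.mul_comm, Nat.mul_add_div (by omega), Nat.div_eq_of_lt this, Nat.add_zero]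

theorem mul_add_mod_eq (b : ℕ) (t : Fin m) : (b * m + t) % m = t := by
  rw [Nat.mul_comm, Nat.mul_add_mod, Nat.mod_eq_of_lt t.isLt]

/-- The word sent by a node that encodes the `b`-th component of its message in block `b`. -/
def sentWord {X : Type*} {M : ℕ} (hm : 0 < m) (f : Fin M → Fin m → X) (x₀ : X) (w : Fin B → Fin M)
    (i : Fin n) : X :=
  -- The idle letter `x₀` fills the last block, in which only the relay has something to deliver,
  -- and any leftover time.
  if h : (i : ℕ) / m < B then f (w ⟨i / m, h⟩) ⟨i % m, Nat.mod_lt _ hm⟩ else x₀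

/-- The relay map of hash-and-forward. -/
def hashRelay (hm : 0 < m) (bin : (Fin m → YR) → Fin K) (word : Fin K → Fin m → XR) (r₀ : XR)
    (i : Fin n) (y : Fin (i : ℕ) → YR) : XR :=
  if h : m ≤ i then
    word (bin fun j => y ⟨(i / m - 1) * m + j, by
      have h1 : 1 ≤ (i : ℕ) / m := (Nat.one_le_div_iff hm).2 h
      have h2 := Nat.div_mul_le_self i m
      have h3 := j.isLt
      have h4 : ((i : ℕ) / m - 1) * m + m = i / m * m := by
        rw [← Nat.succ_mul, Nat.succ_eq_add_one, Nat.sub_add_cancel h1]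
      omega⟩) ⟨i % m, Nat.mod_lt _ hm⟩
  else r₀

theorem sentWord_blockTime {X : Type*} {M : ℕ} (hm : 0 < m) (hn : (B + 1) * m ≤ n)
    (f : Fin M → Fin m → X) (x₀ : X) (w : Fin B → Fin M) (b : Fin B) (t : Fin m) :
    sentWord hm f x₀ w (blockTime hn b.castSucc t) = f (w b) t := by
  have h1 : ((blockTime hn b.castSucc t : Fin n) : ℕ) / m = b := mul_add_div_eq b t
  have h2 : ((blockTime hn b.castSucc t : Fin n) : ℕ) % m = t := mul_add_mod_eq b t
  unfold sentWord
  simp only [h1, h2, b.isLt, dif_pos]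

theorem hashRelay_of_time (hm : 0 < m) (bin : (Fin m → YR) → Fin K) (word : Fin K → Fin m → XR)
    (r₀ : XR) (b : ℕ) (t : Fin m) (h : (b + 1) * m + t < n) (y : Fin ((b + 1) * m + t) → YR) :
    hashRelay hm bin word r₀ ⟨(b + 1) * m + t, h⟩ y =
      word (bin fun j => y ⟨b * m + j, by have := j.isLt; rw [Nat.succ_mul]; omega⟩) t := by
  have h0 : m ≤ (b + 1) * m + t := by rw [Nat.succ_mul]; omega
  unfold hashRelay
  simp only [h0, dif_pos, mul_add_div_eq, mul_add_mod_eq, Nat.add_sub_cancel]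

/-- The concatenation of `B` blocks of hash-and-forward. -/
def blockCode (hm : 0 < m) (hn : (B + 1) * m ≤ n) (f : Fin M₁ → Fin m → X12)
    (h : Fin M₂ → Fin m → X21) (bin : (Fin m → YR) → Fin K) (word : Fin K → Fin m → XR)
    (dec₁ : (Fin m → Y) → Fin M₁ → Fin M₂) (dec₂ : (Fin m → Y) → Fin M₂ → Fin M₁)
    (a₀ : X12) (b₀ : X21) (r₀ : XR) : Code X12 X21 YR XR Y Y n (M₁ ^ B) (M₂ ^ B) where
  enc12 w i _ := sentWord hm f a₀ (finFunctionFinEquiv.symm w) i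
  enc21 v i _ := sentWord hm h b₀ (finFunctionFinEquiv.symm v) i
  relay := hashRelay hm bin word r₀
  -- Component `b` is sent in block `b` and reaches the receiver one block later, hence `b.succ`.
  dec1 y w := finFunctionFinEquiv fun b : Fin B =>
    dec₁ (y ∘ blockTime hn b.succ) (finFunctionFinEquiv.symm w b)
  dec2 y v := finFunctionFinEquiv fun b : Fin B =>
    dec₂ (y ∘ blockTime hn b.succ) (finFunctionFinEquiv.symm v b)

section

variable (hm : 0 < m) (hn : (B + 1) * m ≤ n) (f : Fin M₁ → Fin m → X12)
    (h : Fin M₂ → Fin m → X21) (bin : (Fin m → YR) → Fin K) (word : Fin K → Fin m → XR)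
    (dec₁ : (Fin m → Y) → Fin M₁ → Fin M₂) (dec₂ : (Fin m → Y) → Fin M₂ → Fin M₁)
    (a₀ : X12) (b₀ : X21) (r₀ : XR)

theorem blockCode_isHashForward :
    (blockCode hm hn f h bin word dec₁ dec₂ a₀ b₀ r₀).IsHashForward := by
  refine ⟨⟨fun w i => sentWord hm f a₀ (finFunctionFinEquiv.symm w) i, fun _ _ _ => rfl⟩,
    ⟨fun v i => sentWord hm h b₀ (finFunctionFinEquiv.symm v) i, fun _ _ _ => rfl⟩,
    m, K, bin, word, fun _ => r₀, hm, fun t ht y => ?_, fun b t ht y => ?_⟩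
  · exact dif_neg (not_le.2 t.isLt)
  · exact hashRelay_of_time hm bin word r₀ b t ht y

theorem blockCode_outputProb (W : X12 → X21 → YR → ℝ) (V : XR → Y → ℝ)
    (w : Fin (M₁ ^ B)) (v : Fin (M₂ ^ B)) (yR : Fin n → YR)
    (y1 y2 : Fin n → Y) :
    (blockCode hm hn f h bin word dec₁ dec₂ a₀ b₀ r₀).outputProb W V V w v yR y1 y2 =
      piLaw (fun i => W (sentWord hm f a₀ (finFunctionFinEquiv.symm w) i)
        (sentWord hm h b₀ (finFunctionFinEquiv.symm v) i)) yR *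
      (piLaw (fun i => V (hashRelay hm bin word r₀ i (past yR i))) y1 *
        piLaw (fun i => V (hashRelay hm bin word r₀ i (past yR i))) y2) := by
  simp only [Code.outputProb, piLaw, blockCode, prod_mul_distrib, mul_assoc]

variable [Fintype YR] [Fintype Y]

/-- Union bound over blocks. The downlink word of block `b + 1` depends on the uplink only through
block `b`, so each term is the marginal of a single hash-and-forward block; no independence between
blocks is needed. -/
theorem mean_blocks_le {P : Fin n → YR → ℝ} (hP : ∀ i, P i ∈ stdSimplex ℝ YR) {V : XR → Y → ℝ}
    (hV : ∀ x, V x ∈ stdSimplex ℝ Y) (E : Fin B → (Fin m → Y) → Prop) :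
    mean (piLaw P) (fun yR =>
      mean (piLaw fun i : Fin n => V (hashRelay hm bin word r₀ i (past yR i))) fun z =>
        ind (∃ b, E b (z ∘ blockTime hn b.succ))) ≤
    ∑ b, mean (piLaw fun t => P (blockTime hn b.castSucc t)) fun s =>
      mean (downlinkWord V (word (bin s))) fun z => ind (E b z) := by
  have hpt : ∀ (yR : Fin n → YR) (b : Fin B),
      mean (piLaw fun i : Fin n => V (hashRelay hm bin word r₀ i (past yR i)))
        (fun z => ind (E b (z ∘ blockTime hn b.succ))) =
      mean (downlinkWord V (word (bin (yR ∘ blockTime hn b.castSucc)))) fun z => ind (E b z) :=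
    fun yR b => by
      rw [mean_piLaw_comp (fun i => hV _) (blockTime_injective hn b.succ) fun z => ind (E b z)]
      have : ∀ t, hashRelay hm bin word r₀ (blockTime hn b.succ t)
          (past yR (blockTime hn b.succ t)) = word (bin (yR ∘ blockTime hn b.castSucc)) t :=
        fun t => hashRelay_of_time hm bin word r₀ b t (blockTime hn b.succ t).isLt _
      simp only [this, downlinkWord]
  calc _ ≤ mean (piLaw P) (fun yR => ∑ b, mean (downlinkWord V (word (bin
          (yR ∘ blockTime hn b.castSucc)))) fun z => ind (E b z)) := by
        refine mean_mono (piLaw_mem hP).1 fun yR => ?_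
        simp only [← hpt, ← mean_sum]
        exact mean_mono (piLaw_nonneg fun i => (hV _).1) fun z =>
          ind_le_sum fun ⟨b, hb⟩ => ⟨b, mem_univ _, hb⟩
    _ = _ := by
        rw [mean_sum]
        exact sum_congr rfl fun b _ => mean_piLaw_comp hP (blockTime_injective hn b.castSucc)
          fun s => mean (downlinkWord V (word (bin s))) fun z => ind (E b z)

/-- A uniform message in `Fin (M ^ B)` is a `B`-tuple, each component of which is uniform. -/
theorem sum_finFunction {M : ℕ} [NeZero M] (b : Fin B) (G : Fin M → ℝ) :
    ∑ w : Fin (M ^ B), G (finFunctionFinEquiv.symm w b) = (M : ℝ) ^ B * mean (unif (Fin M)) G := by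
  rw [← mean_piLaw_apply (fun _ : Fin B => unif_mem) b G, mean,
    ← Equiv.sum_comp (finFunctionFinEquiv (m := M) (n := B)), mul_sum]
  refine sum_congr rfl fun w _ => ?_
  have : (M : ℝ) ≠ 0 := NeZero.ne _
  simp [piLaw, unif, this]

theorem sum_average_le [NeZero M₁] [NeZero M₂] {F : Fin (M₁ ^ B) → Fin (M₂ ^ B) → ℝ}
    {G : Fin M₁ → Fin M₂ → ℝ} (hF : ∀ w v, F w v ≤ ∑ b,
      G (finFunctionFinEquiv.symm w b) (finFunctionFinEquiv.symm v b)) :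
    (∑ w, ∑ v, F w v) / ((M₁ ^ B : ℕ) * (M₂ ^ B : ℕ)) ≤
      B * mean (unif (Fin M₁)) fun w => mean (unif (Fin M₂)) fun v => G w v := by
  have h1 : (0 : ℝ) < M₁ := by exact_mod_cast NeZero.pos M₁
  have h2 : (0 : ℝ) < M₂ := by exact_mod_cast NeZero.pos M₂
  push_cast
  rw [div_le_iff₀ (by positivity)]
  calc _ ≤ ∑ w : Fin (M₁ ^ B), ∑ v : Fin (M₂ ^ B), ∑ b,
          G (finFunctionFinEquiv.symm w b) (finFunctionFinEquiv.symm v b) :=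
        sum_le_sum fun w _ => sum_le_sum fun v _ => hF w v
    _ = ∑ b : Fin B, ∑ w : Fin (M₁ ^ B), ∑ v : Fin (M₂ ^ B),
          G (finFunctionFinEquiv.symm w b) (finFunctionFinEquiv.symm v b) := by
        rw [sum_comm]
        simp only [sum_comm (s := (univ : Finset (Fin (M₂ ^ B))))]
        rw [sum_comm]
    _ = ∑ b : Fin B, ((M₁ : ℝ) ^ B * ((M₂ : ℝ) ^ B *
          mean (unif (Fin M₁)) fun w => mean (unif (Fin M₂)) fun v => G w v)) := by
        refine sum_congr rfl fun b _ => ?_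
        simp only [sum_finFunction b (G _)]
        rw [← mul_sum, sum_finFunction b fun w => mean (unif (Fin M₂)) (G w)]
        ring
    _ = _ := by
        rw [sum_const, card_univ, Fintype.card_fin, nsmul_eq_mul]; ring

variable [NeZero M₁] [NeZero M₂] {W : X12 → X21 → YR → ℝ} (hW : ∀ a b, W a b ∈ stdSimplex ℝ YR)
  {V : XR → Y → ℝ} (hV : ∀ x, V x ∈ stdSimplex ℝ Y)

include hW hV

theorem blockCode_errorProb2_le :
    (blockCode hm hn f h bin word dec₁ dec₂ a₀ b₀ r₀).errorProb2 W V V ≤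
      B * mean (unif (Fin M₁)) fun w => mean (unif (Fin M₂)) fun v =>
        blockError (uplinkWord W) (downlinkWord V) f h bin word dec₂ w v := by
  refine sum_average_le fun w v => ?_
  set P : Fin n → YR → ℝ := fun i => W (sentWord hm f a₀ (finFunctionFinEquiv.symm w) i)
        (sentWord hm h b₀ (finFunctionFinEquiv.symm v) i) with hP
  have key := mean_blocks_le hm hn bin word r₀ (P := P) (fun i => hW _ _) hV
    fun b z => dec₂ z (finFunctionFinEquiv.symm v b) ≠ finFunctionFinEquiv.symm w b
  simp only [hP, sentWord_blockTime] at key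
  refine le_of_eq_of_le ?_ key
  unfold mean
  refine sum_congr rfl fun yR _ => ?_
  -- Given `yR` the two receivers are independent, so the other node's output sums out.
  have hQ := (piLaw_mem fun i => hV (hashRelay hm bin word r₀ i (past yR i))).2
  rw [mul_sum, sum_comm]
  refine sum_congr rfl fun y2 _ => ?_
  have hiff : (blockCode hm hn f h bin word dec₁ dec₂ a₀ b₀ r₀).dec2 y2 v ≠ w ↔
      ∃ b, dec₂ (y2 ∘ blockTime hn b.succ) (finFunctionFinEquiv.symm v b) ≠
        finFunctionFinEquiv.symm w b := by
    simp only [blockCode]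
    rw [Ne, ← Equiv.eq_symm_apply, funext_iff, not_forall]
  by_cases hd : (blockCode hm hn f h bin word dec₁ dec₂ a₀ b₀ r₀).dec2 y2 v ≠ w
  · simp only [if_pos hd, ind_of_true (hiff.1 hd), mul_one, blockCode_outputProb, ← mul_sum,
      ← sum_mul, hQ, one_mul]
  · simp only [if_neg hd, ind_of_false fun h => hd (hiff.2 h), sum_const_zero, mul_zero]

theorem blockCode_errorProb1_le :
    (blockCode hm hn f h bin word dec₁ dec₂ a₀ b₀ r₀).errorProb1 W V V ≤
      B * mean (unif (Fin M₁)) fun w => mean (unif (Fin M₂)) fun v =>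
        blockError (fun b a => uplinkWord W a b) (downlinkWord V) h f bin word dec₁ v w := by
  refine sum_average_le (G := fun w v =>
    blockError (fun b a => uplinkWord W a b) (downlinkWord V) h f bin word dec₁ v w) fun w v => ?_
  set P : Fin n → YR → ℝ := fun i => W (sentWord hm f a₀ (finFunctionFinEquiv.symm w) i)
        (sentWord hm h b₀ (finFunctionFinEquiv.symm v) i) with hP
  have key := mean_blocks_le hm hn bin word r₀ (P := P) (fun i => hW _ _) hV
    fun b z => dec₁ z (finFunctionFinEquiv.symm w b) ≠ finFunctionFinEquiv.symm v b
  simp only [hP, sentWord_blockTime] at key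
  refine le_of_eq_of_le ?_ key
  unfold mean
  refine sum_congr rfl fun yR _ => ?_
  have hQ := (piLaw_mem fun i => hV (hashRelay hm bin word r₀ i (past yR i))).2
  rw [mul_sum]
  refine sum_congr rfl fun y1 _ => ?_
  have hiff : (blockCode hm hn f h bin word dec₁ dec₂ a₀ b₀ r₀).dec1 y1 w ≠ v ↔
      ∃ b, dec₁ (y1 ∘ blockTime hn b.succ) (finFunctionFinEquiv.symm w b) ≠
        finFunctionFinEquiv.symm v b := by
    simp only [blockCode]
    rw [Ne, ← Equiv.eq_symm_apply, funext_iff, not_forall]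
  by_cases hd : (blockCode hm hn f h bin word dec₁ dec₂ a₀ b₀ r₀).dec1 y1 w ≠ v
  · simp only [if_pos hd, ind_of_true (hiff.1 hd), mul_one, blockCode_outputProb, ← mul_sum, hQ]
  · simp only [if_neg hd, ind_of_false fun h => hd (hiff.2 h), sum_const_zero, mul_zero]

end

end BlockCode

end TwoWayRelay

namespace TwoWayRelay

open Finset Filter Topology

/-! Achievability and the comparison of the regions. -/

section Main

/-- Time sharing: positions can be assigned types in nearly given proportions. -/
theorem exists_type_assignment {ι : Type*} [Fintype ι] [Nonempty ι] {w : ι → ℝ}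
    (hw : ∀ i, 0 ≤ w i) (hw1 : ∑ i, w i = 1) (m : ℕ) :
    ∃ σ : Fin m → ι, ∀ r : ι → ℝ, (∀ i, 0 ≤ r i) →
      m * ∑ i, w i * r i - ∑ i, r i ≤ ∑ t, r (σ t) := by
  classical
  -- Type `i` gets `⌊m * w i⌋₊` positions, less than one short of its share; the positions left over
  -- get an arbitrary type, which cannot hurt since `r` is nonnegative.
  have hcard : Fintype.card (Σ i, Fin ⌊m * w i⌋₊) ≤ Fintype.card (Fin m) := by
    rw [Fintype.card_sigma, Fintype.card_fin]
    simp only [Fintype.card_fin]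
    have : ((∑ i, ⌊m * w i⌋₊ : ℕ) : ℝ) ≤ m := by
      push_cast
      calc ∑ i, ((⌊m * w i⌋₊ : ℕ) : ℝ) ≤ ∑ i, m * w i :=
            sum_le_sum fun i _ => Nat.floor_le (mul_nonneg (Nat.cast_nonneg m) (hw i))
        _ = m := by rw [← mul_sum, hw1, mul_one]
    exact_mod_cast this
  obtain ⟨e⟩ := Function.Embedding.nonempty_of_card_le hcard
  refine ⟨Function.extend e Sigma.fst fun _ => Classical.arbitrary ι, fun r hr => ?_⟩
  calc m * ∑ i, w i * r i - ∑ i, r i = ∑ i, (m * w i - 1) * r i := by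
        rw [mul_sum, ← sum_sub_distrib]
        exact sum_congr rfl fun i _ => by ring
    _ ≤ ∑ i, (⌊m * w i⌋₊ : ℝ) * r i := by
        gcongr with i _
        · exact hr i
        · linarith [Nat.lt_floor_add_one (m * w i)]
    _ = ∑ x : (Σ i, Fin ⌊m * w i⌋₊), r x.1 := by
        rw [Fintype.sum_sigma]; simp
    _ = ∑ x : (Σ i, Fin ⌊m * w i⌋₊),
          r (Function.extend e Sigma.fst (fun _ => Classical.arbitrary ι) (e x)) :=
        sum_congr rfl fun x _ => by rw [e.injective.extend_apply]
    _ = ∑ t ∈ univ.map e, r (Function.extend e Sigma.fst (fun _ => Classical.arbitrary ι) t) :=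
        by rw [sum_map]
    _ ≤ _ := sum_le_sum_of_subset_of_nonneg (subset_univ _) fun _ _ _ => hr _

/-- Rate accounting per letter: `ε / 4` for the idle block, `ε / 4` for the at most `B` leftover
letters, `ε / 2` for the loss inside a block. -/
theorem rpow_le_pow_of_blocks {R ε : ℝ} {n m B M : ℕ} (hn : n ≤ m * (B + 1) + B)
    (hm : m * (B + 1) ≤ n) (hB : R ≤ ε / 4 * (B + 1)) (hN : B * R ≤ n * (ε / 4))
    (hM : (2 : ℝ) ^ (m * (R - ε / 2)) ≤ M) (hε : 0 < ε) :
    (2 : ℝ) ^ (n * (R - ε)) ≤ (M ^ B : ℕ) := by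
  have hn' : (n : ℝ) ≤ m * (B + 1) + B := by exact_mod_cast hn
  have hm' : (m : ℝ) * (B + 1) ≤ n := by exact_mod_cast hm
  have hM0 : (0 : ℝ) < M := (by positivity : (0 : ℝ) < _).trans_le hM
  have hM1 : 1 ≤ M := by exact_mod_cast hM0
  push_cast
  -- For small `R` a single message suffices; otherwise `R - ε / 2` is positive and may multiply the
  -- bound on `n`.
  rcases le_or_gt R (ε / 2) with h | h
  · calc (2 : ℝ) ^ (n * (R - ε)) ≤ 1 :=
          Real.rpow_le_one_of_one_le_of_nonpos (by norm_num)
            (mul_nonpos_of_nonneg_of_nonpos (Nat.cast_nonneg n) (by linarith))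
      _ ≤ (M : ℝ) ^ B := one_le_pow₀ (by exact_mod_cast hM1)
  · calc (2 : ℝ) ^ (n * (R - ε)) ≤ (2 : ℝ) ^ (m * (R - ε / 2) * B) := by
          refine Real.rpow_le_rpow_of_exponent_le (by norm_num) ?_
          have h1 : (m : ℝ) * R ≤ n * (ε / 4) := by
            calc (m : ℝ) * R ≤ m * (ε / 4 * (B + 1)) := by gcongr
              _ = m * (B + 1) * (ε / 4) := by ring
              _ ≤ _ := by gcongr
          have h2 : (n : ℝ) * (R - ε / 2) ≤ (m * (B + 1) + B) * (R - ε / 2) :=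
            mul_le_mul_of_nonneg_right hn' (by linarith)
          have h3 : (0 : ℝ) ≤ (m + B) * (ε / 2) := by positivity
          linarith
      _ = ((2 : ℝ) ^ (m * (R - ε / 2))) ^ B := by
          rw [← Real.rpow_mul_natCast (by norm_num)]
      _ ≤ (M : ℝ) ^ B := by gcongr

variable {X12 X21 YR XR Y : Type*}

/-- A code for an achievable pair within `ε / 2`, taken with tolerance `ε / 2`, serves the limit
with tolerance `ε`. -/
theorem isClosed_hfAchievable [Fintype YR] [Fintype Y] (W : X12 → X21 → YR → ℝ)
    (V1 V2 : XR → Y → ℝ) : IsClosed (hfAchievable W V1 V2) := by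
  refine isClosed_of_closure_subset fun R hR => ?_
  have hnonneg : R ∈ {R : ℝ × ℝ | 0 ≤ R.1 ∧ 0 ≤ R.2} := by
    have hsub : hfAchievable W V1 V2 ⊆ {R : ℝ × ℝ | 0 ≤ R.1 ∧ 0 ≤ R.2} :=
      fun R' hR' => ⟨hR'.1, hR'.2.1⟩
    refine closure_minimal hsub ?_ hR
    exact (isClosed_le continuous_const continuous_fst).inter
      (isClosed_le continuous_const continuous_snd)
  refine ⟨hnonneg.1, hnonneg.2, fun ε hε => ?_⟩
  obtain ⟨R', hR', hd⟩ := Metric.mem_closure_iff.1 hR (ε / 2) (by positivity)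
  rw [Prod.dist_eq, max_lt_iff, Real.dist_eq, Real.dist_eq, abs_lt, abs_lt] at hd
  obtain ⟨N, hN⟩ := hR'.2.2 (ε / 2) (by positivity)
  refine ⟨N, fun n hn => ?_⟩
  obtain ⟨M12, M21, c, hc, h1, h2, e1, e2⟩ := hN n hn
  refine ⟨M12, M21, c, hc, le_trans ?_ h1, le_trans ?_ h2, by linarith, by linarith⟩
  · refine Real.rpow_le_rpow_of_exponent_le (by norm_num) ?_
    exact mul_le_mul_of_nonneg_left (by linarith) (Nat.cast_nonneg n)
  · refine Real.rpow_le_rpow_of_exponent_le (by norm_num) ?_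
    exact mul_le_mul_of_nonneg_left (by linarith) (Nat.cast_nonneg n)

variable [Fintype X12] [Fintype X21] [Fintype YR] [Fintype XR] [Fintype Y]

theorem nonempty_of_mem_stdSimplex {α : Type*} [Fintype α] {p : α → ℝ}
    (hp : p ∈ stdSimplex ℝ α) : Nonempty α := by
  by_contra h
  rw [not_nonempty_iff] at h
  simpa using hp.2

/-- Rate pairs on time-sharing combinations of Shannon's rate pairs are achievable by binning at
the relay when the downlink is very strong for each of the inputs. -/
theorem mem_hfAchievable_of_timeSharing {ι : Type*} [Fintype ι] {w : ι → ℝ} (hw : ∀ i, 0 ≤ w i)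
    (hw1 : ∑ i, w i = 1) {p12 : ι → X12 → ℝ}
    (h12 : ∀ i, p12 i ∈ stdSimplex ℝ X12) {p21 : ι → X21 → ℝ} (h21 : ∀ i, p21 i ∈ stdSimplex ℝ X21)
    {pR : ι → XR → ℝ} (hR : ∀ i, pR i ∈ stdSimplex ℝ XR) {W : X12 → X21 → YR → ℝ}
    (hW : ∀ a b, W a b ∈ stdSimplex ℝ YR) {V : XR → Y → ℝ} (hV : ∀ x, V x ∈ stdSimplex ℝ Y)
    (hs : ∀ i, StrongDownlink (p12 i) (p21 i) (pR i) W V) {r : ι → ℝ × ℝ}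
    (hr : ∀ i, r i ∈ shannonRect (p12 i) (p21 i) W) :
    ∑ i, w i • r i ∈ hfAchievable W V V := by
  have hι : Nonempty ι := nonempty_of_mem_stdSimplex ⟨hw, hw1⟩
  obtain ⟨i₀⟩ := id hι
  obtain ⟨a₀⟩ := nonempty_of_mem_stdSimplex (h12 i₀)
  obtain ⟨b₀⟩ := nonempty_of_mem_stdSimplex (h21 i₀)
  obtain ⟨r₀⟩ := nonempty_of_mem_stdSimplex (hR i₀)
  have e₁ : (∑ i, w i • r i).1 = ∑ i, w i * (r i).1 := by simp [Prod.fst_sum]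
  have e₂ : (∑ i, w i • r i).2 = ∑ i, w i * (r i).2 := by simp [Prod.snd_sum]
  set R := ∑ i, w i • r i with hRdef
  have hR₁ : 0 ≤ R.1 := e₁ ▸ sum_nonneg fun i _ => mul_nonneg (hw i) (hr i).1
  have hR₂ : 0 ≤ R.2 := e₂ ▸ sum_nonneg fun i _ => mul_nonneg (hw i) (hr i).2.1
  refine ⟨hR₁, hR₂, fun ε hε => ?_⟩
  -- The number of blocks is fixed before their length grows. It makes the idle block cost at most
  -- `ε / 4` in either rate.
  obtain ⟨B, hB⟩ := exists_nat_ge (4 * (R.1 + R.2) / ε)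
  rw [div_le_iff₀ hε] at hB
  -- Two demands on `δ`: `5 * δ ≤ ε / 2`, for the loss `4 * δ` of the block code and `δ` for
  -- rounding in time sharing, and `B * δ ≤ ε` for the union bound over blocks.
  set δ := ε / (10 * (B + 1)) with hδ
  have hδ0 : 0 < δ := by positivity
  have hδε : δ * (10 * (B + 1)) = ε := by rw [hδ]; field_simp
  have hδ1 : 5 * δ ≤ ε / 2 := by
    have : 0 ≤ δ * B := by positivity
    linarith
  have hδ2 : B * δ ≤ ε := by nlinarith
  have hblock := eventually_exists_block_code h12 h21 hR hW hV
    (fun i => uplinkInfo12_eq (h12 i) (h21 i) hW) (fun i => uplinkInfo21_eq (h12 i) (h21 i) hW)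
    (fun i => neg_relayEntropyGivenBoth_eq (h12 i) (h21 i) hW)
    (fun i => channelInfo_eq (hR i) hV)
    (fun i => by
      rw [uplinkInfo12_add_relayEntropyGivenBoth (h12 i) (h21 i) hW]
      exact (le_max_right _ _).trans (hs i))
    (fun i => by
      rw [uplinkInfo21_add_relayEntropyGivenBoth (h12 i) (h21 i) hW]
      exact (le_max_left _ _).trans (hs i)) hδ0
  have hdiv : Tendsto (fun n : ℕ => n / (B + 1)) atTop atTop :=
    Nat.tendsto_div_const_atTop (Nat.succ_ne_zero B)
  have hlarge : ∀ c d : ℝ, 0 < d → ∀ᶠ m : ℕ in atTop, c ≤ m * d := fun c d hd =>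
    (tendsto_natCast_atTop_atTop.atTop_mul_const hd).eventually_ge_atTop c
  refine eventually_atTop.1 ?_
  filter_upwards [hdiv.eventually hblock, hdiv.eventually (eventually_gt_atTop 0),
    hdiv.eventually (hlarge (∑ i, (r i).1) δ hδ0), hdiv.eventually (hlarge (∑ i, (r i).2) δ hδ0),
    hlarge (B * R.1) (ε / 4) (by positivity), hlarge (B * R.2) (ε / 4) (by positivity)]
    with n hcode hm c₁ c₂ d₁ d₂
  set m := n / (B + 1) with hmdef
  obtain ⟨σ, hσ⟩ := exists_type_assignment hw hw1 m
  obtain ⟨M₁, M₂, K, f, h, bin, word, dec₁, dec₂, hM₁, hM₂, herr⟩ := hcode σ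
  have hmn : m * (B + 1) ≤ n := Nat.div_mul_le_self n (B + 1)
  have hnm : n ≤ m * (B + 1) + B := by
    have : n < m * (B + 1) + (B + 1) := Nat.lt_div_mul_add (Nat.succ_pos B)
    omega
  have hrate : ∀ (I : ι → ℝ) (s : ι → ℝ) (S : ℝ) (M : ℕ), (∀ i, 0 ≤ s i) → (∀ i, s i ≤ I i) →
      S = ∑ i, w i * s i → ∑ i, s i ≤ m * δ →
      (2 : ℝ) ^ (∑ t, I (σ t) - 4 * (m * δ)) ≤ M → (2 : ℝ) ^ (m * (S - ε / 2)) ≤ M := by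
    intro I s S M hs0 hsI hS hc hM
    refine le_trans (Real.rpow_le_rpow_of_exponent_le (by norm_num) ?_) hM
    have h1 := hσ s hs0
    have h2 : ∑ t, s (σ t) ≤ ∑ t, I (σ t) := sum_le_sum fun t _ => hsI _
    rw [← hS] at h1
    have h3 := mul_le_mul_of_nonneg_left hδ1 (Nat.cast_nonneg (α := ℝ) m)
    linarith
  have q₁ := hrate _ (fun i => (r i).1) R.1 M₁ (fun i => (hr i).1) (fun i => (hr i).2.2.1) e₁ c₁ hM₁
  have q₂ := hrate _ (fun i => (r i).2) R.2 M₂ (fun i => (hr i).2.1) (fun i => (hr i).2.2.2) e₂ c₂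
    hM₂
  have hpos : ∀ {x : ℝ} {M : ℕ}, (2 : ℝ) ^ x ≤ M → NeZero M := fun {x M} hx => ⟨by
    rintro rfl
    have : (0 : ℝ) < 2 ^ x := by positivity
    rw [Nat.cast_zero] at hx
    linarith⟩
  have := hpos hM₁
  have := hpos hM₂
  have hn : (B + 1) * m ≤ n := by rwa [mul_comm]
  have hWm : ∀ (a : Fin m → X12) (b : Fin m → X21) s, 0 ≤ uplinkWord W a b s :=
    fun a b => (piLaw_mem fun t => hW _ _).1
  have hVm : ∀ (x : Fin m → XR) y, 0 ≤ downlinkWord V x y := fun x => (piLaw_mem fun t => hV _).1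
  simp only [mean_add] at herr
  have n₂ : 0 ≤ mean (unif (Fin M₁)) fun w => mean (unif (Fin M₂)) fun v =>
      blockError (uplinkWord W) (downlinkWord V) f h bin word dec₂ w v :=
    mean_nonneg unif_mem.1 fun w => mean_nonneg unif_mem.1 fun v => mean_nonneg (hWm _ _) fun s =>
      mean_nonneg (hVm _) fun y => ind_nonneg _
  have n₁ : 0 ≤ mean (unif (Fin M₁)) fun w => mean (unif (Fin M₂)) fun v =>
      blockError (fun b a => uplinkWord W a b) (downlinkWord V) h f bin word dec₁ v w :=
    mean_nonneg unif_mem.1 fun w => mean_nonneg unif_mem.1 fun v => mean_nonneg (hWm _ _) fun s =>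
      mean_nonneg (hVm _) fun y => ind_nonneg _
  have hB0 : (0 : ℝ) ≤ B := Nat.cast_nonneg B
  refine ⟨M₁ ^ B, M₂ ^ B, blockCode hm hn f h bin word dec₁ dec₂ a₀ b₀ r₀,
    blockCode_isHashForward .., rpow_le_pow_of_blocks hnm hmn ?_ d₁ q₁ hε,
    rpow_le_pow_of_blocks hnm hmn ?_ d₂ q₂ hε,
    (blockCode_errorProb1_le hm hn f h bin word dec₁ dec₂ a₀ b₀ r₀ hW hV).trans
      (le_trans ?_ hδ2),
    (blockCode_errorProb2_le hm hn f h bin word dec₁ dec₂ a₀ b₀ r₀ hW hV).trans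
      (le_trans ?_ hδ2)⟩
  · linarith
  · linarith
  · exact mul_le_mul_of_nonneg_left (by linarith) hB0
  · exact mul_le_mul_of_nonneg_left (by linarith) hB0

/-! ### Comparison of the single-letter regions. -/

theorem hfRatesAt_subset_shannonRect (p12 : X12 → ℝ) (p21 : X21 → ℝ) (W : X12 → X21 → YR → ℝ)
    (V1 V2 : XR → Y → ℝ) : hfRatesAt p12 p21 W V1 V2 ⊆ shannonRect p12 p21 W := by
  rintro R ⟨k, q, -, h0, h1, h2, h3⟩
  exact ⟨h0, h1, h2.trans (min_le_left _ _), h3.trans (min_le_left _ _)⟩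

variable {p12 : X12 → ℝ} {p21 : X21 → ℝ} {pR : XR → ℝ} {W : X12 → X21 → YR → ℝ} {V : XR → Y → ℝ}

/-- By the chain rule the strong downlink says `I ≤ C - H` in both directions, so each minimum is
attained by its uplink term. -/
theorem hfRect_eq_shannonRect (h12 : p12 ∈ stdSimplex ℝ X12) (h21 : p21 ∈ stdSimplex ℝ X21)
    (hW : ∀ a b, W a b ∈ stdSimplex ℝ YR) (hs : StrongDownlink p12 p21 pR W V)
    {U : Type*} [Fintype U] {q : U × XR → ℝ} (hq1 : downlinkRate1 q V V = channelInfo pR V)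
    (hq2 : downlinkRate2 q V V = channelInfo pR V) :
    hfRect p12 p21 q W V V = shannonRect p12 p21 W := by
  have i12 := uplinkInfo12_add_relayEntropyGivenBoth h12 h21 hW
  have i21 := uplinkInfo21_add_relayEntropyGivenBoth h12 h21 hW
  obtain ⟨s1, s2⟩ := max_le_iff.1 hs
  unfold hfRect shannonRect
  rw [hq1, hq2, min_eq_left (le_max_of_le_left (by linarith)),
    min_eq_left (le_max_of_le_left (by linarith))]

theorem hfRatesAt_eq_shannonRect [DecidableEq XR] (h12 : p12 ∈ stdSimplex ℝ X12)
    (h21 : p21 ∈ stdSimplex ℝ X21) (hR : pR ∈ stdSimplex ℝ XR)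
    (hW : ∀ a b, W a b ∈ stdSimplex ℝ YR) (hV : ∀ x, V x ∈ stdSimplex ℝ Y)
    (hs : StrongDownlink p12 p21 pR W V) :
    hfRatesAt p12 p21 W V V = shannonRect p12 p21 W := by
  refine (hfRatesAt_subset_shannonRect p12 p21 W V V).antisymm fun R hRm => ?_
  -- The auxiliary alphabets in `hfRatesAt` are the `Fin k`, so `U` is a relabelled copy of `X_R`.
  let φ : Fin (Fintype.card XR) ≃ XR := (Fintype.equivFin XR).symm
  let q : Fin (Fintype.card XR) × XR → ℝ := fun ω => if φ ω.1 = ω.2 then pR ω.2 else 0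
  refine ⟨Fintype.card XR, q, ⟨fun ω => ?_, ?_⟩, ?_⟩
  · simp only [q]
    split_ifs
    · exact hR.1 _
    · exact le_rfl
  · rw [Fintype.sum_prod_type, ← hR.2, ← Equiv.sum_comp φ]
    simp [q]
  · rwa [hfRect_eq_shannonRect h12 h21 hW hs (downlinkRate1_diag (φ := φ) hR hV fun _ _ => rfl)
      (downlinkRate2_diag (φ := φ) hR hV fun _ _ => rfl)]

end Main

end TwoWayRelay

theorem mainTheorem4 {X12 X21 YR XR Y : Type*}
    [Fintype X12] [Fintype X21] [Fintype YR] [Fintype XR] [DecidableEq XR] [Fintype Y]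
    (W : X12 → X21 → YR → ℝ) (hW : ∀ a b, W a b ∈ stdSimplex ℝ YR)
    (V1 V2 : XR → Y → ℝ) (hV1 : ∀ x, V1 x ∈ stdSimplex ℝ Y) (hV2 : ∀ x, V2 x ∈ stdSimplex ℝ Y)
    (hV : ∀ x y, V1 x y = V2 x y) :
    (∀ p12 ∈ stdSimplex ℝ X12, ∀ p21 ∈ stdSimplex ℝ X21, ∀ pR ∈ stdSimplex ℝ XR,
      TwoWayRelay.StrongDownlink p12 p21 pR W V1 →
        TwoWayRelay.downlinkRate1 (TwoWayRelay.diagLaw pR) V1 V2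
            = TwoWayRelay.channelInfo pR V1 ∧
        TwoWayRelay.downlinkRate2 (TwoWayRelay.diagLaw pR) V1 V2
            = TwoWayRelay.channelInfo pR V1 ∧
        TwoWayRelay.hfRect p12 p21 (TwoWayRelay.diagLaw pR) W V1 V2
            = TwoWayRelay.shannonRect p12 p21 W ∧
        TwoWayRelay.hfRatesAt p12 p21 W V1 V2 = TwoWayRelay.shannonRect p12 p21 W ∧
        TwoWayRelay.shannonRect p12 p21 W ⊆ TwoWayRelay.hfAchievable W V1 V2) ∧
    ((∀ p12 ∈ stdSimplex ℝ X12, ∀ p21 ∈ stdSimplex ℝ X21, ∃ pR ∈ stdSimplex ℝ XR,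
      TwoWayRelay.StrongDownlink p12 p21 pR W V1) →
        closure (TwoWayRelay.hfRates W V1 V2) = closure (TwoWayRelay.shannonRates W) ∧
        closure (convexHull ℝ (TwoWayRelay.hfRates W V1 V2)) = TwoWayRelay.shannonInnerBound W ∧
        TwoWayRelay.shannonInnerBound W ⊆ TwoWayRelay.hfAchievable W V1 V2) := by
  obtain rfl : V1 = V2 := funext fun x => funext fun y => hV x y
  refine ⟨fun p12 h12 p21 h21 pR hR hs => ?_, fun hall => ?_⟩
  · have r1 := TwoWayRelay.downlinkRate1_diag (φ := Equiv.refl XR)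
      (q := TwoWayRelay.diagLaw pR) hR hV1 fun _ _ => rfl
    have r2 := TwoWayRelay.downlinkRate2_diag (φ := Equiv.refl XR)
      (q := TwoWayRelay.diagLaw pR) hR hV1 fun _ _ => rfl
    refine ⟨r1, r2, TwoWayRelay.hfRect_eq_shannonRect h12 h21 hW hs r1 r2,
      TwoWayRelay.hfRatesAt_eq_shannonRect h12 h21 hR hW hV1 hs, fun R hRm => ?_⟩
    -- No time sharing is needed for fixed inputs: a single type of weight one.
    simpa using TwoWayRelay.mem_hfAchievable_of_timeSharing (ι := Unit) (w := fun _ => 1)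
      (fun _ => zero_le_one) (by simp) (fun _ => h12) (fun _ => h21) (fun _ => hR) hW hV1
      (fun _ => hs) (r := fun _ => R) fun _ => hRm
  · have heq : TwoWayRelay.hfRates W V1 V1 = TwoWayRelay.shannonRates W := by
      ext R
      refine exists_congr fun p12 => and_congr_right fun h12 => exists_congr fun p21 =>
        and_congr_right fun h21 => ?_
      obtain ⟨pR, hR, hs⟩ := hall p12 h12 p21 h21
      rw [TwoWayRelay.hfRatesAt_eq_shannonRect h12 h21 hR hW hV1 hs]
    refine ⟨by rw [heq], by rw [heq, TwoWayRelay.shannonInnerBound], ?_⟩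
    refine closure_minimal (fun R hRm => ?_) (TwoWayRelay.isClosed_hfAchievable W V1 V1)
    obtain ⟨ι, _, w, r, hw0, hw1, hr, rfl⟩ := mem_convexHull_iff_exists_fintype.1 hRm
    -- Each Shannon pair in the convex combination brings its own inputs, and with them its own
    -- `pR`; these are the types shared inside a block.
    choose p12 h12 p21 h21 hr using hr
    choose pR hR hs using fun i => hall (p12 i) (h12 i) (p21 i) (h21 i)
    exact TwoWayRelay.mem_hfAchievable_of_timeSharing hw0 hw1 h12 h21 hR hW hV1 hs hr
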